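/- For $0<k<1$ let $K(k)=\int_0^{\pi/2}\frac{d\theta}{\sqrt{1-k^2\sin^2\theta}}$ be the complete elliptic integral of the first kind. Let $r>0$, let $q=e^{-\pi\sqrt r}$, let $k_r\in(0,1)$ be the modulus determined by $K\big(\sqrt{1-k_r^2}\big)/K(k_r)=\sqrt r$, and write $K=K(k_r)$ and $K'=K\big(\sqrt{1-k_r^2}\big)$. For $u\in\mathbb C$ with $|\operatorname{Im}u|<K'$ put $$\mathrm{cd}_1(q,u)=\frac{2\pi}{Kk_r}\sum_{n=0}^{\infty}\frac{(-1)^n q^{n+1/2}\cos\left((2n+3)\frac{\pi}{2K}u\right)}{1-q^{2n+1}},$$ a series that converges absolutely. Then: 1) the series $\sum_{n\ge 1,\ n\text{ odd}}\frac{q^{n/2}}{1-q^n}$ converges and $$\lim_{y\to K}\frac{\mathrm{cd}_1(q,y)}{y-K}=1+\frac{2\pi^2}{K^2k_r}\sum_{n\ge 1,\ n\text{ odd}}\frac{q^{n/2}}{1-q^n},$$ where $y$ may tend to $K$ through complex values $y\ne K$; 2) $\mathrm{cd}_1(q,0)=1$, $\mathrm{cd}_1(q,K)=0$, $\mathrm{cd}_1(q,2K)=-1$,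 and $\mathrm{cd}_1(q,u+2K)=-\mathrm{cd}_1(q,u)$ for every $u\in\mathbb C$ with $|\operatorname{Im}u|<K'$. -/

import Mathlib

open Filter Topology

noncomputable section

/-- The complete elliptic integral of the first kind at modulus `k` (used for `0 < k < 1`):
`K(k) = ∫_0^{π/2} dθ / √(1 - k² sin² θ)`. -/
def ellipticK (k : ℝ) : ℝ :=
  ∫ θ in (0 : ℝ)..(Real.pi / 2), 1 / Real.sqrt (1 - k ^ 2 * Real.sin θ ^ 2)

/-- `k` is a modulus in `(0, 1)` with `K(k') / K(k) = √r`, where `k' = √(1 - k²)`.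
For every `r > 0` there is exactly one such `k`. -/
def IsEllipticModulus (r k : ℝ) : Prop :=
  0 < k ∧ k < 1 ∧ ellipticK (Real.sqrt (1 - k ^ 2)) / ellipticK k = Real.sqrt r

/-- The modulus `k_r`, the number `k` in `(0, 1)` with `K(k') / K(k) = √r`. -/
def ellipticModulus (r : ℝ) : ℝ :=
  Classical.epsilon (IsEllipticModulus r)

/-- The nome `q = e^{-π √r}`. -/
def nome (r : ℝ) : ℝ :=
  Real.exp (-Real.pi * Real.sqrt r)

/-- The `n`-th term
`(-1)^n q^{n + 1/2} cos((2n + 3) (π / (2K)) u) / (1 - q^{2n + 1})`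
of the series of `cd₁(q, u)`, where `q = e^{-π √r}` and `K = K(k_r)`. -/
def cd1Term (r : ℝ) (u : ℂ) (n : ℕ) : ℂ :=
  (-1) ^ n * ((nome r ^ ((n : ℝ) + 1 / 2) : ℝ) : ℂ)
      * Complex.cos ((2 * (n : ℂ) + 3)
          * ((Real.pi / (2 * ellipticK (ellipticModulus r)) : ℝ) : ℂ) * u)
    / ((1 - nome r ^ (2 * n + 1) : ℝ) : ℂ)

/-- `cd₁(q, u) = (2π / (K k_r)) ∑_{n ≥ 0}
(-1)^n q^{n + 1/2} cos((2n + 3) (π / (2K)) u) / (1 - q^{2n + 1})`, where `q = e^{-π √r}`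
and `K = K(k_r)`. -/
def cd1 (r : ℝ) (u : ℂ) : ℂ :=
  ((2 * Real.pi / (ellipticK (ellipticModulus r) * ellipticModulus r) : ℝ) : ℂ)
    * ∑' n : ℕ, cd1Term r u n

end

/-! Put t = √r, q = e^{-πt} and c_n = q^{n+1/2}/(1 - q^{2n+1}) (`cschCoeff`). At u = K every cosine
in the series vanishes, and differentiating there cancels the alternating signs, leaving a multiple
of ∑ (2n+3) c_n = ∑ (2n+1) c_n + 2 ∑ c_n. At u = 0 the series is ∑ (-1)^n c_n. The theorem thus
rests on two Lambert series, 4 ∑ (-1)^n c_n = θ₂² (`altLambert_eq`) and 4 ∑ (2n+1) c_n = θ₂²θ₃²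
(`oddLambert_eq`), together with K = (π/2) θ₃², k = θ₂²/θ₃² and K' = tK.

For the Lambert series, multiply ∑ (-1)^m q^{m²} x^m by ∑ c_n x^n, with n over all integers. The
coefficients of the product obey a first-order recursion, so they are C (-1)^N q^{(N+1/2)²} for one
constant C (`thetaCschConv_eq`). Setting x = -1, or differentiating at x = 1, expresses both Lambert
series through C. Clausen's rearrangement of a double series shows that C at 2t is the alternating
series at t (`appellConst_eq_altLambert`).

What remains is proved by one device, `eq_of_two_mul_invariant`: a function of t that is unchanged
by t ↦ 2t equals its limit at infinity. It applies to ∑ (-1)^n c_n / θ₂², to Jacobi's quotient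
θ₁'/(θ₂θ₃θ₄), and to Gauss's integral at (θ₃², θ₄²), for which doubling t is one step of the
arithmetic-geometric mean. The last case evaluates K; Poisson summation, t ↦ 1/t, gives K'; and
strict monotonicity of K'/K identifies k_r with θ₂²/θ₃². -/

noncomputable section

/-! ### Theta constants as sums over the integers -/

/-- The Gaussian `x ↦ e^{-π t x²}`. -/
def gauss (t x : ℝ) : ℝ := Real.exp (-Real.pi * t * x ^ 2)

/-- The sign `(-1)^n` of an integer. -/
def intSign (n : ℤ) : ℝ := (-1) ^ n

lemma gauss_pos (t x : ℝ) : 0 < gauss t x := Real.exp_pos _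

lemma gauss_neg (t x : ℝ) : gauss t (-x) = gauss t x := by simp [gauss]

/-- The parallelogram law for squares; every doubling identity below comes from it. -/
lemma gauss_add_mul_gauss_sub (t x y : ℝ) :
    gauss t (x + y) * gauss t (x - y) = gauss (2 * t) x * gauss (2 * t) y := by
  simp only [gauss, ← Real.exp_add]; congr 1; ring

lemma intSign_add (m n : ℤ) : intSign (m + n) = intSign m * intSign n :=
  zpow_add₀ (by norm_num) m n

lemma intSign_neg (n : ℤ) : intSign (-n) = intSign n := by
  rw [intSign, zpow_neg, intSign, ← inv_zpow]; norm_num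

lemma intSign_one : intSign 1 = -1 := by simp [intSign]

lemma intSign_zero : intSign 0 = 1 := by simp [intSign]

lemma intSign_sub (m n : ℤ) : intSign (m - n) = intSign m * intSign n := by
  rw [sub_eq_add_neg, intSign_add, intSign_neg]

lemma intSign_mul_self (n : ℤ) : intSign n * intSign n = 1 := by
  rw [← intSign_sub, sub_self, intSign_zero]

lemma abs_intSign (n : ℤ) : |intSign n| = 1 := by simp [intSign, abs_zpow]

lemma intSign_natCast (n : ℕ) : intSign n = (-1) ^ n := by simp [intSign]

/-- The cross term 2tαn of the shifted square is absorbed by the parameter |α|t of the two-variable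
theta bound; its cases of degree 0 and 1 cover a linear weight. -/
lemma summable_mul_gauss {t : ℝ} (ht : 0 < t) (α C : ℝ) {f : ℤ → ℝ}
    (hf : ∀ n : ℤ, |f n| ≤ C * (1 + |(n : ℝ)|)) :
    Summable fun n : ℤ => f n * gauss t (n + α) := by
  have h0 := summable_pow_mul_jacobiTheta₂_term_bound (|α| * t) ht 0
  have h1 := summable_pow_mul_jacobiTheta₂_term_bound (|α| * t) ht 1
  refine Summable.of_norm_bounded ((h0.add h1).mul_left C) fun n => ?_
  rw [norm_mul, Real.norm_eq_abs, Real.norm_eq_abs, abs_of_pos (gauss_pos _ _)]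
  have hg : gauss t (n + α) ≤
      Real.exp (-Real.pi * (t * n ^ 2 - 2 * (|α| * t) * |(n : ℤ)|)) := by
    rw [gauss, Real.exp_le_exp]
    have h : -(|α| * |(n : ℝ)|) ≤ α * n := by rw [← abs_mul]; exact neg_abs_le _
    have : t * n ^ 2 - 2 * (|α| * t) * |(n : ℝ)| ≤ t * (n + α) ^ 2 := by
      nlinarith [mul_le_mul_of_nonneg_left h ht.le, mul_nonneg ht.le (sq_nonneg α)]
    push_cast
    nlinarith [Real.pi_pos]
  calc |f n| * gauss t (n + α) ≤ (C * (1 + |(n : ℝ)|)) *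
        Real.exp (-Real.pi * (t * n ^ 2 - 2 * (|α| * t) * |(n : ℤ)|)) :=
        mul_le_mul (hf n) hg (gauss_pos _ _).le ((abs_nonneg _).trans (hf n))
    _ = _ := by push_cast; ring

lemma summable_gauss {t : ℝ} (ht : 0 < t) (α : ℝ) : Summable fun n : ℤ => gauss t (n + α) := by
  simpa using summable_mul_gauss ht α 1 (f := fun _ => 1) (fun n => by simp)

lemma summable_intSign_mul_gauss {t : ℝ} (ht : 0 < t) (α : ℝ) :
    Summable fun n : ℤ => intSign n * gauss t (n + α) :=
  summable_mul_gauss ht α 1 (fun n => by rw [abs_intSign]; simp)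

lemma summable_intSign_mul_linear_mul_gauss {t : ℝ} (ht : 0 < t) (α : ℝ) :
    Summable fun n : ℤ => intSign n * (2 * n + 1) * gauss t (n + α) :=
  summable_mul_gauss ht α 2 (fun n => by
    rw [abs_mul, abs_intSign, one_mul]
    refine (abs_add_le _ _).trans ?_
    rw [abs_mul]; norm_num; linarith [abs_nonneg (n : ℝ)])

/-- The theta constant `θ₃ = ∑ q^{n²}`, `q = e^{-π t}`. -/
def thetaThree (t : ℝ) : ℝ := ∑' n : ℤ, gauss t n

/-- The theta constant `θ₄ = ∑ (-1)^n q^{n²}`, `q = e^{-π t}`. -/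
def thetaFour (t : ℝ) : ℝ := ∑' n : ℤ, intSign n * gauss t n

/-- The theta constant `θ₂ = ∑ q^{(n + 1/2)²}`, `q = e^{-π t}`. -/
def thetaTwo (t : ℝ) : ℝ := ∑' n : ℤ, gauss t (n + 1 / 2)

/-- The derivative theta constant `θ₁' = ∑ (-1)^n (2n + 1) q^{(n + 1/2)²}`, `q = e^{-π t}`. -/
def thetaOneDeriv (t : ℝ) : ℝ := ∑' n : ℤ, intSign n * (2 * n + 1) * gauss t (n + 1 / 2)

lemma summable_thetaThree {t : ℝ} (ht : 0 < t) : Summable fun n : ℤ => gauss t n := by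
  simpa using summable_gauss ht 0

lemma summable_thetaFour {t : ℝ} (ht : 0 < t) :
    Summable fun n : ℤ => intSign n * gauss t n := by
  simpa using summable_intSign_mul_gauss ht 0

/-! ### Vanishing by symmetry, and rearrangement of double sums over the integers. -/

lemma tsum_eq_zero_of_antisymm {f : ℤ → ℝ} (e : ℤ ≃ ℤ) (h : ∀ n, f (e n) = -f n) :
    ∑' n, f n = 0 := by
  have h1 := e.tsum_eq f
  simp only [h, tsum_neg] at h1
  linarith

/-- The reflection `n ↦ -1 - n` of the integers. -/
def reflectHalf : ℤ ≃ ℤ := Equiv.subLeft (-1)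

lemma reflectHalf_apply (n : ℤ) : reflectHalf n = -1 - n := rfl

lemma intSign_reflectHalf (n : ℤ) : intSign (reflectHalf n) = -intSign n := by
  rw [reflectHalf_apply, intSign_sub, intSign_neg, intSign_one]; ring

lemma tsum_intSign_mul_gauss_half (t : ℝ) : ∑' n : ℤ, intSign n * gauss t (n + 1 / 2) = 0 := by
  refine tsum_eq_zero_of_antisymm reflectHalf fun n => ?_
  rw [intSign_reflectHalf, reflectHalf_apply, ← gauss_neg]
  push_cast
  rw [show -((-1 : ℝ) - n + 1 / 2) = n + 1 / 2 by ring]; ring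

lemma tsum_intSign_mul_self_mul_gauss (t : ℝ) :
    ∑' n : ℤ, intSign n * (n : ℝ) * gauss t n = 0 := by
  refine tsum_eq_zero_of_antisymm (Equiv.neg ℤ) fun n => ?_
  simp [intSign_neg, gauss_neg]

/-- Pairs of integers are of the form `(a + b, a - b)` or `(a + b + 1, a - b)`. -/
def sumDiffEquiv : (ℤ × ℤ) ⊕ (ℤ × ℤ) ≃ ℤ × ℤ :=
  Equiv.ofBijective
    (Sum.elim (fun p => (p.1 + p.2, p.1 - p.2)) (fun p => (p.1 + p.2 + 1, p.1 - p.2))) (by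
      constructor
      · rintro (⟨a, b⟩ | ⟨a, b⟩) (⟨c, d⟩ | ⟨c, d⟩) h <;>
          simp only [Sum.elim_inl, Sum.elim_inr, Prod.mk.injEq] at h <;>
          simp only [Sum.inl.injEq, Sum.inr.injEq, Prod.mk.injEq, reduceCtorEq] <;> omega
      · rintro ⟨m, n⟩
        rcases Int.emod_two_eq_zero_or_one (m + n) with h | h
        · exact ⟨Sum.inl ((m + n) / 2, (m - n) / 2), by
            simp only [Sum.elim_inl, Prod.mk.injEq]; omega⟩
        · exact ⟨Sum.inr ((m + n - 1) / 2, (m - n - 1) / 2), by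
            simp only [Sum.elim_inr, Prod.mk.injEq]; omega⟩)

lemma tsum_mul_tsum_eq_sumDiff {f g : ℤ → ℝ} (hf : Summable f) (hg : Summable g) :
    (∑' n, f n) * ∑' n, g n = ∑' p : ℤ × ℤ, f (p.1 + p.2) * g (p.1 - p.2)
      + ∑' p : ℤ × ℤ, f (p.1 + p.2 + 1) * g (p.1 - p.2) := by
  have hs : Summable fun p : ℤ × ℤ => f p.1 * g p.2 :=
    summable_mul_of_summable_norm hf.norm hg.norm
  rw [tsum_mul_tsum_of_summable_norm hf.norm hg.norm, ← sumDiffEquiv.tsum_eq]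
  have hs' := sumDiffEquiv.summable_iff.2 hs
  exact Summable.tsum_sum (hs'.comp_injective Sum.inl_injective)
    (hs'.comp_injective Sum.inr_injective)

lemma tsum_mul_add_mul {A B C D : ℤ → ℝ} (hA : Summable A) (hB : Summable B) (hC : Summable C)
    (hD : Summable D) : ∑' p : ℤ × ℤ, (A p.1 * B p.2 + C p.1 * D p.2) =
      (∑' n, A n) * (∑' n, B n) + (∑' n, C n) * ∑' n, D n := by
  rw [tsum_mul_tsum_of_summable_norm hA.norm hB.norm,
    tsum_mul_tsum_of_summable_norm hC.norm hD.norm,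
    Summable.tsum_add (summable_mul_of_summable_norm hA.norm hB.norm)
      (summable_mul_of_summable_norm hC.norm hD.norm)]

lemma tsum_mul_sep {A B : ℤ → ℝ} (hA : Summable A) (hB : Summable B) :
    ∑' p : ℤ × ℤ, A p.1 * B p.2 = (∑' n, A n) * (∑' n, B n) :=
  (tsum_mul_tsum_of_summable_norm hA.norm hB.norm).symm

lemma gauss_mul_sumDiff_even (t α : ℝ) (a b : ℤ) :
    gauss t (((a + b : ℤ) : ℝ) + α) * gauss t (((a - b : ℤ) : ℝ) + α) =
      gauss (2 * t) (a + α) * gauss (2 * t) b := by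
  rw [← gauss_add_mul_gauss_sub]; push_cast; congr 2 <;> ring

lemma gauss_mul_sumDiff_odd (t α : ℝ) (a b : ℤ) :
    gauss t (((a + b + 1 : ℤ) : ℝ) + α) * gauss t (((a - b : ℤ) : ℝ) + α) =
      gauss (2 * t) (a + 1 / 2 + α) * gauss (2 * t) (b + 1 / 2) := by
  rw [← gauss_add_mul_gauss_sub]; push_cast; congr 2 <;> ring

/-! ### Theta identities relating t and 2t. -/

section Doubling

variable {t : ℝ}

lemma thetaThree_sq (ht : 0 < t) :
    thetaThree t ^ 2 = thetaThree (2 * t) ^ 2 + thetaTwo (2 * t) ^ 2 := by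
  have h2 : 0 < 2 * t := by positivity
  have e1 := gauss_mul_sumDiff_even t 0
  have e2 := gauss_mul_sumDiff_odd t 0
  simp only [add_zero] at e1 e2
  simp only [sq, thetaThree, thetaTwo]
  rw [tsum_mul_tsum_eq_sumDiff (summable_thetaThree ht) (summable_thetaThree ht)]
  simp only [e1, e2]
  rw [tsum_mul_sep (summable_thetaThree h2) (summable_thetaThree h2),
    tsum_mul_sep (summable_gauss h2 _) (summable_gauss h2 _)]

lemma thetaFour_sq (ht : 0 < t) :
    thetaFour t ^ 2 = thetaThree (2 * t) ^ 2 - thetaTwo (2 * t) ^ 2 := by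
  have h2 : 0 < 2 * t := by positivity
  have e1 := gauss_mul_sumDiff_even t 0
  have e2 := gauss_mul_sumDiff_odd t 0
  simp only [add_zero] at e1 e2
  simp only [sq, thetaThree, thetaTwo, thetaFour]
  rw [tsum_mul_tsum_eq_sumDiff (summable_thetaFour ht) (summable_thetaFour ht),
    ← tsum_mul_sep (summable_thetaThree h2) (summable_thetaThree h2),
    ← tsum_mul_sep (summable_gauss h2 _) (summable_gauss h2 _), sub_eq_add_neg, ← tsum_neg]
  congr 1
  · refine tsum_congr fun p => ?_
    rw [← e1, intSign_add, intSign_sub]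
    linear_combination (intSign_mul_self p.2 * intSign p.1 * intSign p.1 + intSign_mul_self p.1) *
      gauss t ((p.1 + p.2 : ℤ) : ℝ) * gauss t ((p.1 - p.2 : ℤ) : ℝ)
  · refine tsum_congr fun p => ?_
    rw [← e2, intSign_add, intSign_add, intSign_sub, intSign_one]
    linear_combination -(intSign_mul_self p.2 * intSign p.1 * intSign p.1 + intSign_mul_self p.1) *
      gauss t ((p.1 + p.2 + 1 : ℤ) : ℝ) * gauss t ((p.1 - p.2 : ℤ) : ℝ)

lemma thetaThree_mul_thetaFour (ht : 0 < t) :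
    thetaThree t * thetaFour t = thetaFour (2 * t) ^ 2 := by
  have h2 : 0 < 2 * t := by positivity
  have e1 := gauss_mul_sumDiff_even t 0
  have e2 := gauss_mul_sumDiff_odd t 0
  simp only [add_zero] at e1 e2
  -- A vanishing square is added so that both parity classes of index pairs have a matching product.
  have h0 : thetaFour (2 * t) ^ 2 = (∑' n : ℤ, intSign n * gauss (2 * t) n) *
      (∑' n : ℤ, intSign n * gauss (2 * t) n) + (∑' n : ℤ, intSign n * gauss (2 * t) (n + 1 / 2)) *
      (∑' n : ℤ, intSign n * gauss (2 * t) (n + 1 / 2)) := by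
    rw [tsum_intSign_mul_gauss_half, thetaFour]; ring
  rw [h0, thetaThree, thetaFour,
    tsum_mul_tsum_eq_sumDiff (summable_thetaThree ht) (summable_thetaFour ht),
    ← tsum_mul_sep (summable_thetaFour h2) (summable_thetaFour h2),
    ← tsum_mul_sep (summable_intSign_mul_gauss h2 _) (summable_intSign_mul_gauss h2 _)]
  congr 1
  · refine tsum_congr fun p => ?_
    rw [intSign_sub]
    linear_combination intSign p.1 * intSign p.2 * e1 p.1 p.2
  · refine tsum_congr fun p => ?_
    rw [intSign_sub]
    linear_combination intSign p.1 * intSign p.2 * e2 p.1 p.2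

lemma tsum_shift (f : ℤ → ℝ) : ∑' n : ℤ, f (n + 1) = ∑' n, f n :=
  (Equiv.addRight (1 : ℤ)).tsum_eq f

lemma summable_shift {f : ℤ → ℝ} (hf : Summable f) : Summable fun n : ℤ => f (n + 1) :=
  (Equiv.addRight (1 : ℤ)).summable_iff.2 hf

lemma thetaTwo_sq (ht : 0 < t) :
    thetaTwo t ^ 2 = 2 * thetaTwo (2 * t) * thetaThree (2 * t) := by
  have h2 : 0 < 2 * t := by positivity
  have h0 : 2 * thetaTwo (2 * t) * thetaThree (2 * t) =
      (∑' n : ℤ, gauss (2 * t) (n + 1 / 2)) * (∑' n : ℤ, gauss (2 * t) n) +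
      (∑' n : ℤ, gauss (2 * t) ((n + 1 : ℤ) : ℝ)) * (∑' n : ℤ, gauss (2 * t) (n + 1 / 2)) := by
    rw [tsum_shift (fun n : ℤ => gauss (2 * t) n), thetaTwo, thetaThree]; ring
  rw [h0, sq, thetaTwo, tsum_mul_tsum_eq_sumDiff (summable_gauss ht _) (summable_gauss ht _),
    ← tsum_mul_sep (summable_gauss h2 _) (summable_thetaThree h2),
    ← tsum_mul_sep (summable_shift (summable_thetaThree h2)) (summable_gauss h2 _)]
  congr 1
  · exact tsum_congr fun p => gauss_mul_sumDiff_even t _ _ _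
  · refine tsum_congr fun p => (gauss_mul_sumDiff_odd t _ _ _).trans ?_
    congr 2
    push_cast; ring

/-- The weight 2m+1 splits as (2a+1) + 2b when m = a+b and as 2(a+1) + (2b+1) when m = a+b+1. In
each class one summand gives θ₁'θ₄ at 2t and the other a product of two sums that vanish by
symmetry. -/
lemma thetaOneDeriv_mul_thetaTwo (ht : 0 < t) :
    thetaOneDeriv t * thetaTwo t = 2 * thetaOneDeriv (2 * t) * thetaFour (2 * t) := by
  have h2 : 0 < 2 * t := by positivity
  have s1 : Summable fun n : ℤ => intSign n * (n : ℝ) * gauss (2 * t) n := by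
    simpa using summable_mul_gauss h2 0 1 (f := fun n => intSign n * (n : ℝ)) (fun n => by
      rw [abs_mul, abs_intSign]; linarith)
  have s2 := summable_intSign_mul_linear_mul_gauss h2 (1 / 2)
  have s3 := summable_intSign_mul_gauss h2 (1 / 2)
  have s4 := summable_thetaFour h2
  have h0 : 2 * thetaOneDeriv (2 * t) * thetaFour (2 * t) =
      ((∑' n : ℤ, intSign n * (2 * n + 1) * gauss (2 * t) (n + 1 / 2)) *
        (∑' n : ℤ, intSign n * gauss (2 * t) n) +
      (∑' n : ℤ, 2 * (intSign n * gauss (2 * t) (n + 1 / 2))) *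
        (∑' n : ℤ, intSign n * (n : ℝ) * gauss (2 * t) n)) +
      ((∑' n : ℤ, intSign (n + 1) * gauss (2 * t) ((n + 1 : ℤ) : ℝ)) *
        (∑' n : ℤ, intSign n * (2 * n + 1) * gauss (2 * t) (n + 1 / 2)) +
      (∑' n : ℤ, 2 * (intSign (n + 1) * ((n + 1 : ℤ) : ℝ) * gauss (2 * t) ((n + 1 : ℤ) : ℝ))) *
        (∑' n : ℤ, intSign n * gauss (2 * t) (n + 1 / 2))) := by
    rw [tsum_shift (fun n : ℤ => intSign n * gauss (2 * t) n), tsum_intSign_mul_gauss_half,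
      tsum_intSign_mul_self_mul_gauss, thetaOneDeriv, thetaFour]; ring
  rw [h0, thetaOneDeriv, thetaTwo,
    tsum_mul_tsum_eq_sumDiff (summable_intSign_mul_linear_mul_gauss ht _) (summable_gauss ht _),
    ← tsum_mul_add_mul s2 s4 (s3.mul_left 2) s1,
    ← tsum_mul_add_mul (summable_shift s4) s2 ((summable_shift s1).mul_left 2) s3]
  congr 1
  · refine tsum_congr fun p => ?_
    rw [mul_assoc, gauss_mul_sumDiff_even, intSign_add]
    push_cast; ring
  · refine tsum_congr fun p => ?_
    rw [mul_assoc, gauss_mul_sumDiff_odd, intSign_add (p.1 + p.2), intSign_add p.1 1,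
      intSign_add, intSign_one,
      show (p.1 : ℝ) + 1 / 2 + 1 / 2 = ((p.1 + 1 : ℤ) : ℝ) by push_cast; ring]
    push_cast; ring

lemma thetaThree_pow_four (ht : 0 < t) :
    thetaThree t ^ 4 = thetaTwo t ^ 4 + thetaFour t ^ 4 := by
  have h3 := thetaThree_sq ht
  have h4 := thetaFour_sq ht
  have h2 := thetaTwo_sq ht
  rw [show thetaThree t ^ 4 = (thetaThree t ^ 2) ^ 2 by ring,
    show thetaTwo t ^ 4 = (thetaTwo t ^ 2) ^ 2 by ring,
    show thetaFour t ^ 4 = (thetaFour t ^ 2) ^ 2 by ring, h2, h3, h4]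
  ring

end Doubling

/-! ### Positivity and the inversion t ↦ 1/t. -/

section Positivity

variable {t : ℝ}

lemma thetaThree_pos (ht : 0 < t) : 0 < thetaThree t :=
  (summable_thetaThree ht).tsum_pos (fun _ => (gauss_pos _ _).le) 0 (gauss_pos _ _)

lemma thetaTwo_pos (ht : 0 < t) : 0 < thetaTwo t :=
  (summable_gauss ht _).tsum_pos (fun _ => (gauss_pos _ _).le) 0 (gauss_pos _ _)

lemma thetaThree_inv (ht : 0 < t) : thetaThree (1 / t) = Real.sqrt t * thetaThree t := by
  have h := Real.tsum_exp_neg_mul_int_sq (a := 1 / t) (by positivity)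
  rw [thetaThree, thetaThree]
  simp only [gauss]
  rw [h, Real.sqrt_eq_rpow, one_div t, Real.inv_rpow ht.le, one_div, inv_inv]
  congr 1
  refine tsum_congr fun n => ?_
  congr 1; field_simp

/-- Poisson summation with the linear term πin: it encodes the sign (-1)^n on one side and becomes a
shift by a half on the other. -/
lemma thetaFour_inv (ht : 0 < t) : thetaFour (1 / t) = Real.sqrt t * thetaTwo t := by
  have h := Complex.tsum_exp_neg_quadratic (a := ((1 / t : ℝ) : ℂ))
    (by rw [Complex.ofReal_re]; positivity) (Complex.I / 2)
  have hl : ∀ n : ℤ, Complex.exp (-Real.pi * ((1 / t : ℝ) : ℂ) * n ^ 2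
      + 2 * Real.pi * (Complex.I / 2) * n) = ((intSign n * gauss (1 / t) n : ℝ) : ℂ) := by
    intro n
    rw [Complex.exp_add, gauss, intSign]
    push_cast
    rw [mul_comm]
    congr 1
    rw [← Complex.exp_pi_mul_I, ← Complex.exp_int_mul]
    congr 1; ring
  have hr : ∀ n : ℤ, Complex.exp (-Real.pi / ((1 / t : ℝ) : ℂ)
      * (n + Complex.I * (Complex.I / 2)) ^ 2) = ((gauss t (((n - 1 : ℤ) : ℝ) + 1 / 2) : ℝ) : ℂ) := by
    intro n
    rw [gauss, show Complex.I * (Complex.I / 2) = -1 / 2 by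
      rw [← mul_div_assoc, Complex.I_mul_I]]
    push_cast
    congr 1
    field_simp
    ring
  simp only [hl, hr] at h
  rw [← Complex.ofReal_tsum, ← Complex.ofReal_tsum] at h
  have h2 : ((1 / t : ℝ) : ℂ) ^ (1 / 2 : ℂ) = (((1 / t) ^ (1 / 2 : ℝ) : ℝ) : ℂ) := by
    rw [Complex.ofReal_cpow (by positivity)]; norm_num
  rw [h2] at h
  have h3 : ∑' n : ℤ, gauss t (((n - 1 : ℤ) : ℝ) + 1 / 2) = thetaTwo t := by
    rw [thetaTwo]
    exact (Equiv.subRight (1 : ℤ)).tsum_eq (fun n : ℤ => gauss t ((n : ℝ) + 1 / 2))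
  rw [h3] at h
  rw [thetaFour, Real.sqrt_eq_rpow]
  rw [one_div t, Real.inv_rpow ht.le] at h
  rw [one_div t]
  have := Complex.ofReal_injective (by push_cast at h ⊢; exact h :
    ((∑' n : ℤ, intSign n * gauss t⁻¹ n : ℝ) : ℂ) = ((1 / (t ^ (1 / 2 : ℝ))⁻¹ * thetaTwo t : ℝ) : ℂ))
  rw [this, one_div, inv_inv]

/-- The alternating series hides the sign; inversion turns it into a series of positive terms. -/
lemma thetaFour_pos (ht : 0 < t) : 0 < thetaFour t := by
  have h := thetaFour_inv (t := 1 / t) (by positivity)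
  rw [one_div_one_div] at h
  rw [h]
  exact mul_pos (Real.sqrt_pos.2 (by positivity)) (thetaTwo_pos (by positivity))

lemma thetaTwo_inv (ht : 0 < t) : thetaTwo (1 / t) = Real.sqrt t * thetaFour t := by
  have h := thetaFour_inv (t := 1 / t) (by positivity)
  rw [one_div_one_div] at h
  rw [h, ← mul_assoc, ← Real.sqrt_mul ht.le, mul_one_div_cancel ht.ne', Real.sqrt_one, one_mul]

end Positivity

/-! ### Lambert series for squares of theta constants -/

/-- The real power `q^x` of the nome `q = e^{-π t}`. -/
def nomePow (t x : ℝ) : ℝ := Real.exp (-Real.pi * t * x)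

lemma nomePow_pos (t x : ℝ) : 0 < nomePow t x := Real.exp_pos _

lemma nomePow_zero (t : ℝ) : nomePow t 0 = 1 := by simp [nomePow]

lemma nomePow_add (t x y : ℝ) : nomePow t (x + y) = nomePow t x * nomePow t y := by
  rw [nomePow, nomePow, nomePow, ← Real.exp_add]; congr 1; ring

lemma gauss_eq_nomePow (t x : ℝ) : gauss t x = nomePow t (x ^ 2) := rfl

lemma nomePow_neg_mul (t x : ℝ) : nomePow t (-x) * nomePow t x = 1 := by
  rw [← nomePow_add, neg_add_cancel, nomePow_zero]

lemma nomePow_mul_nat (t x : ℝ) (n : ℕ) : nomePow t (x * n) = nomePow t x ^ n := by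
  rw [nomePow, nomePow, ← Real.exp_nat_mul]; congr 1; ring

lemma nomePow_two_mul (t x : ℝ) : nomePow (2 * t) x = nomePow t (2 * x) := by
  rw [nomePow, nomePow]; congr 1; ring

lemma nomePow_lt_one {t x : ℝ} (ht : 0 < t) (hx : 0 < x) : nomePow t x < 1 := by
  rw [nomePow, Real.exp_lt_one_iff, neg_mul, neg_mul, neg_lt_zero]
  have := Real.pi_pos
  positivity

lemma nomePow_le_nomePow {t x y : ℝ} (ht : 0 < t) (h : x ≤ y) : nomePow t y ≤ nomePow t x := by
  rw [nomePow, nomePow, Real.exp_le_exp]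
  have : Real.pi * t * x ≤ Real.pi * t * y :=
    mul_le_mul_of_nonneg_left h (by have := Real.pi_pos; positivity)
  linarith

/-- The hyperbolic cosecant coefficient `1 / (q^{-(n + 1/2)} - q^{n + 1/2})`, which equals
`q^{n + 1/2} / (1 - q^{2n + 1})`. -/
def cschCoeff (t : ℝ) (n : ℤ) : ℝ := (nomePow t (-((n : ℝ) + 1 / 2)) - nomePow t (n + 1 / 2))⁻¹

section

variable {t : ℝ}

lemma int_add_half_ne_zero (n : ℤ) : (n : ℝ) + 1 / 2 ≠ 0 := by
  intro h
  have : ((2 * n + 1 : ℤ) : ℝ) = 0 := by push_cast; linarith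
  have := Int.cast_eq_zero.1 this
  omega

lemma nomePow_injective (ht : 0 < t) {x y : ℝ} (h : nomePow t x = nomePow t y) : x = y := by
  have h := Real.exp_injective h
  have : Real.pi * t ≠ 0 := mul_ne_zero Real.pi_ne_zero ht.ne'
  apply mul_left_cancel₀ this
  linarith

/-- The definition cleared of its denominator; this is what drives the recursion
`thetaCschConv_recursion`. -/
lemma nomePow_neg_mul_cschCoeff (ht : 0 < t) (n : ℤ) :
    nomePow t (-((n : ℝ) + 1 / 2)) * cschCoeff t n =
      1 + nomePow t (n + 1 / 2) * cschCoeff t n := by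
  have h : nomePow t (-((n : ℝ) + 1 / 2)) - nomePow t (n + 1 / 2) ≠ 0 := by
    rw [sub_ne_zero]
    intro h
    have := nomePow_injective ht h
    exact int_add_half_ne_zero n (by linarith)
  have := mul_inv_cancel₀ h
  rw [cschCoeff]
  linear_combination this

lemma cschCoeff_reflectHalf (n : ℤ) : cschCoeff t (reflectHalf n) = -cschCoeff t n := by
  rw [cschCoeff, cschCoeff, reflectHalf_apply, ← inv_neg, neg_sub]
  congr 2 <;> congr 1 <;> push_cast <;> ring

lemma cschCoeff_natCast (n : ℕ) :
    cschCoeff t n = nomePow t (n + 1 / 2) / (1 - nomePow t (2 * n + 1)) := by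
  have h : nomePow t (2 * n + 1) = nomePow t (n + 1 / 2) * nomePow t (n + 1 / 2) := by
    rw [← nomePow_add]; congr 1; ring
  have h' : 1 - nomePow t (2 * n + 1) =
      (nomePow t (-((n : ℝ) + 1 / 2)) - nomePow t (n + 1 / 2)) * nomePow t (n + 1 / 2) := by
    rw [sub_mul, nomePow_neg_mul, h]
  rw [cschCoeff, h', Int.cast_natCast, div_mul_cancel_right₀ (nomePow_pos _ _).ne']

lemma hasSum_cschCoeff (ht : 0 < t) (n : ℕ) :
    HasSum (fun k : ℕ => nomePow t (((n : ℝ) + 1 / 2) * (2 * k + 1))) (cschCoeff t n) := by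
  have h := (hasSum_geometric_of_lt_one (nomePow_pos t (2 * n + 1)).le
    (nomePow_lt_one ht (by positivity))).mul_left (nomePow t (n + 1 / 2))
  rw [cschCoeff_natCast, div_eq_mul_inv (nomePow t _)]
  have e : ∀ k : ℕ, nomePow t (((n : ℝ) + 1 / 2) * (2 * k + 1)) =
      nomePow t (n + 1 / 2) * nomePow t (2 * n + 1) ^ k := by
    intro k
    rw [← nomePow_mul_nat, ← nomePow_add]; congr 1; ring
  simpa only [e] using h

lemma cschCoeff_natCast_pos (ht : 0 < t) (n : ℕ) : 0 < cschCoeff t n := by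
  rw [cschCoeff_natCast]
  exact div_pos (nomePow_pos _ _) (sub_pos.2 (nomePow_lt_one ht (by positivity)))

lemma cschCoeff_natCast_le (ht : 0 < t) (n : ℕ) :
    cschCoeff t n ≤ nomePow t (1 / 2) / (1 - nomePow t 1) * nomePow t 1 ^ n := by
  have hle : nomePow t (2 * n + 1) ≤ nomePow t 1 :=
    nomePow_le_nomePow ht (by have : (0 : ℝ) ≤ n := n.cast_nonneg
                              linarith)
  have h1 : 0 < 1 - nomePow t 1 := sub_pos.2 (nomePow_lt_one ht one_pos)
  rw [cschCoeff_natCast, div_mul_eq_mul_div, ← nomePow_mul_nat, ← nomePow_add,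
    show (1 : ℝ) / 2 + 1 * n = n + 1 / 2 by ring]
  exact div_le_div_of_nonneg_left (nomePow_pos _ _).le h1 (by linarith)

/-- The coefficients `cschCoeff` decay like `q^n`. -/
lemma summable_linear_mul_cschCoeff_mul_exp (ht : 0 < t) {δ : ℝ} (hδ : 2 * δ < Real.pi * t) :
    Summable fun n : ℕ => (2 * (n : ℝ) + 3) * cschCoeff t n * Real.exp ((2 * n + 3) * δ) := by
  -- The ratio of the dominating series is q e^{2δ}.
  have hq : ‖Real.exp (2 * δ - Real.pi * t)‖ < 1 := by
    rw [Real.norm_of_nonneg (Real.exp_pos _).le, Real.exp_lt_one_iff]; linarith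
  have h0 := summable_pow_mul_geometric_of_norm_lt_one 0 hq
  have h1 := summable_pow_mul_geometric_of_norm_lt_one 1 hq
  refine Summable.of_nonneg_of_le (fun n => mul_nonneg (mul_nonneg (by positivity)
    (cschCoeff_natCast_pos ht n).le) (Real.exp_pos _).le) (fun n => ?_)
    (((h1.mul_left 2).add (h0.mul_left 3)).mul_left
      (nomePow t (1 / 2) / (1 - nomePow t 1) * Real.exp (3 * δ)))
  have he : nomePow t 1 ^ n * Real.exp ((2 * n + 3) * δ) =
      Real.exp (3 * δ) * Real.exp (2 * δ - Real.pi * t) ^ n := by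
    rw [nomePow, ← Real.exp_nat_mul, ← Real.exp_nat_mul, ← Real.exp_add, ← Real.exp_add]
    congr 1; ring
  calc (2 * (n : ℝ) + 3) * cschCoeff t n * Real.exp ((2 * n + 3) * δ)
      ≤ (2 * (n : ℝ) + 3) * (nomePow t (1 / 2) / (1 - nomePow t 1) * nomePow t 1 ^ n) *
          Real.exp ((2 * n + 3) * δ) :=
        mul_le_mul_of_nonneg_right (mul_le_mul_of_nonneg_left (cschCoeff_natCast_le ht n)
          (by positivity)) (Real.exp_pos _).le
    _ = _ := by
        rw [mul_assoc, mul_assoc, he]; ring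

lemma summable_natCast_linear_mul_cschCoeff (ht : 0 < t) :
    Summable fun n : ℕ => (2 * (n : ℝ) + 1) * cschCoeff t n := by
  have h := summable_linear_mul_cschCoeff_mul_exp (δ := 0) ht
    (by have := Real.pi_pos; rw [mul_zero]; positivity)
  refine Summable.of_nonneg_of_le (fun n => mul_nonneg (by positivity)
    (cschCoeff_natCast_pos ht n).le) (fun n => ?_) h
  rw [mul_zero, Real.exp_zero, mul_one]
  exact mul_le_mul_of_nonneg_right (by linarith) (cschCoeff_natCast_pos ht n).le

lemma cast_reflectHalf (n : ℤ) : ((reflectHalf n : ℤ) : ℝ) = -1 - n := by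
  rw [reflectHalf_apply]; push_cast; ring

lemma reflectHalf_natCast (n : ℕ) : (-((n : ℤ) + 1)) = reflectHalf n := by
  rw [reflectHalf_apply]; ring

lemma summable_linear_mul_cschCoeff (ht : 0 < t) :
    Summable fun n : ℤ => (2 * (n : ℝ) + 1) * cschCoeff t n := by
  have h := summable_natCast_linear_mul_cschCoeff ht
  refine Summable.of_nat_of_neg_add_one (by simpa using h) ?_
  refine h.congr fun n => ?_
  rw [reflectHalf_natCast, cschCoeff_reflectHalf, cast_reflectHalf]
  push_cast; ring

lemma summable_mul_cschCoeff (ht : 0 < t) {f : ℤ → ℝ} (hf : ∀ n, |f n| ≤ 1) :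
    Summable fun n : ℤ => f n * cschCoeff t n := by
  refine Summable.of_norm_bounded (summable_linear_mul_cschCoeff ht).norm fun n => ?_
  rw [norm_mul, norm_mul]
  refine mul_le_mul_of_nonneg_right ((hf n).trans ?_) (norm_nonneg _)
  have : (1 : ℤ) ≤ |2 * n + 1| := Int.one_le_abs (by omega)
  rw [Real.norm_eq_abs]
  exact_mod_cast this

lemma summable_cschCoeff (ht : 0 < t) : Summable fun n : ℤ => cschCoeff t n := by
  simpa using summable_mul_cschCoeff ht (f := fun _ => 1) (by simp)

lemma summable_natCast_cschCoeff (ht : 0 < t) : Summable fun n : ℕ => cschCoeff t n :=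
  (summable_cschCoeff ht).comp_injective Nat.cast_injective

lemma summable_intSign_mul_cschCoeff (ht : 0 < t) :
    Summable fun n : ℤ => intSign n * cschCoeff t n :=
  summable_mul_cschCoeff ht fun n => (abs_intSign n).le

lemma tsum_int_eq_of_reflectHalf {f : ℤ → ℝ} (hf : Summable f)
    (h : ∀ n, f (reflectHalf n) = f n) : ∑' n : ℤ, f n = 2 * ∑' n : ℕ, f n := by
  have hn : Summable fun n : ℕ => f n := hf.comp_injective Nat.cast_injective
  rw [tsum_of_nat_of_neg_add_one hn (by simpa only [reflectHalf_natCast, h] using hn)]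
  simp only [reflectHalf_natCast, h]
  ring

/-- The alternating Lambert series `∑_{n ≥ 0} (-1)^n q^{n + 1/2} / (1 - q^{2n + 1})`. -/
def altLambert (t : ℝ) : ℝ := ∑' n : ℕ, (-1) ^ n * cschCoeff t n

/-- The Lambert series `∑_{n ≥ 0} (2n + 1) q^{n + 1/2} / (1 - q^{2n + 1})`. -/
def oddLambert (t : ℝ) : ℝ := ∑' n : ℕ, (2 * (n : ℝ) + 1) * cschCoeff t n

lemma tsum_intSign_mul_cschCoeff (ht : 0 < t) :
    ∑' n : ℤ, intSign n * cschCoeff t n = 2 * altLambert t := by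
  rw [tsum_int_eq_of_reflectHalf (summable_intSign_mul_cschCoeff ht), altLambert]
  · simp only [intSign_natCast]
  · intro n; rw [intSign_reflectHalf, cschCoeff_reflectHalf]; ring

lemma tsum_linear_mul_cschCoeff (ht : 0 < t) :
    ∑' n : ℤ, (2 * (n : ℝ) + 1) * cschCoeff t n = 2 * oddLambert t := by
  rw [tsum_int_eq_of_reflectHalf (summable_linear_mul_cschCoeff ht), oddLambert]
  · simp only [Int.cast_natCast]
  · intro n; rw [cast_reflectHalf, cschCoeff_reflectHalf]; ring

/-! ### The product of a theta series with the cosecant series. -/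

/-- The coefficients of the product of `∑ (-1)^m q^{m²} x^m` and
`∑ x^n / (q^{-(n + 1/2)} - q^{n + 1/2})`. -/
def thetaCschConv (t : ℝ) (N : ℤ) : ℝ := ∑' m : ℤ, intSign m * gauss t m * cschCoeff t (N - m)

/-- The bijection `(N, m) ↦ (m, N - m)` of pairs of integers. -/
def convEquiv : ℤ × ℤ ≃ ℤ × ℤ where
  toFun p := (p.2, p.1 - p.2)
  invFun p := (p.1 + p.2, p.1)
  left_inv p := by simp
  right_inv p := by simp

lemma tsum_mul_tsum_eq_conv {f g : ℤ → ℝ} (hf : Summable f) (hg : Summable g) :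
    (∑' n, f n) * ∑' n, g n = ∑' N : ℤ, ∑' m : ℤ, f m * g (N - m) := by
  have hs : Summable fun p : ℤ × ℤ => f p.1 * g p.2 :=
    summable_mul_of_summable_norm hf.norm hg.norm
  rw [tsum_mul_tsum_of_summable_norm hf.norm hg.norm, ← convEquiv.tsum_eq]
  exact (convEquiv.summable_iff.2 hs).tsum_prod

lemma summable_mul_conv {f g : ℤ → ℝ} (hf : Summable f) (hg : Summable g) (N : ℤ) :
    Summable fun m : ℤ => f m * g (N - m) := by
  have hs : Summable fun p : ℤ × ℤ => f p.1 * g p.2 :=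
    summable_mul_of_summable_norm hf.norm hg.norm
  exact hs.comp_injective (i := fun m : ℤ => (m, N - m)) fun a b h => (Prod.mk.inj h).1

lemma summable_mul_tsum_conv {f g : ℤ → ℝ} (hf : Summable f) (hg : Summable g) :
    Summable fun N : ℤ => ∑' m : ℤ, f m * g (N - m) := by
  have hs : Summable fun p : ℤ × ℤ => f p.1 * g p.2 :=
    summable_mul_of_summable_norm hf.norm hg.norm
  exact (convEquiv.summable_iff.2 hs).prod

/-- Multiply by q^{-(N+1/2)} = q^{-(N-m+1/2)} q^{-m} and apply `nomePow_neg_mul_cschCoeff`. The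
constant 1 contributes ∑ (-1)^m q^{m²-m}, which is zero; the other part, reindexed by m ↦ m-1, is
the coefficient at N-1. -/
lemma thetaCschConv_recursion (ht : 0 < t) (N : ℤ) :
    thetaCschConv t N = -nomePow t (2 * N) * thetaCschConv t (N - 1) := by
  have hs := summable_mul_conv (summable_thetaFour ht) (summable_cschCoeff ht)
  have hterm : ∀ m : ℤ, nomePow t (-((N : ℝ) + 1 / 2)) *
      (intSign m * gauss t m * cschCoeff t (N - m)) =
      nomePow t (-(1 / 4)) * (intSign m * gauss t (((m - 1 : ℤ) : ℝ) + 1 / 2)) +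
      -nomePow t (N - 1 / 2) *
        (intSign (m - 1) * gauss t ((m - 1 : ℤ) : ℝ) * cschCoeff t (N - 1 - (m - 1))) := by
    intro m
    have h := nomePow_neg_mul_cschCoeff ht (N - m)
    have e1 : nomePow t (-((N : ℝ) + 1 / 2)) =
        nomePow t (-(((N - m : ℤ) : ℝ) + 1 / 2)) * nomePow t (-m) := by
      rw [← nomePow_add]; congr 1; push_cast; ring
    have e2 : nomePow t (-m) * gauss t m =
        nomePow t (-(1 / 4)) * gauss t (((m - 1 : ℤ) : ℝ) + 1 / 2) := by
      rw [gauss_eq_nomePow, gauss_eq_nomePow, ← nomePow_add, ← nomePow_add]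
      congr 1; push_cast; ring
    have e3 : nomePow t (-m) * gauss t m * nomePow t (((N - m : ℤ) : ℝ) + 1 / 2) =
        nomePow t (N - 1 / 2) * gauss t ((m - 1 : ℤ) : ℝ) := by
      rw [gauss_eq_nomePow, gauss_eq_nomePow, ← nomePow_add, ← nomePow_add, ← nomePow_add]
      congr 1; push_cast; ring
    rw [e1, intSign_sub, intSign_one, show N - 1 - (m - 1) = N - m by ring]
    linear_combination intSign m * (nomePow t (-m) * gauss t m) * h + intSign m * e2 +
      intSign m * cschCoeff t (N - m) * e3
  have hz : ∑' m : ℤ, intSign m * gauss t (((m - 1 : ℤ) : ℝ) + 1 / 2) = 0 := by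
    rw [← tsum_shift]
    have := tsum_intSign_mul_gauss_half t
    simp only [add_sub_cancel_right, intSign_add, intSign_one, mul_neg, mul_one, neg_mul, tsum_neg,
      this, neg_zero]
  have hsz : Summable fun m : ℤ => intSign m * gauss t (((m - 1 : ℤ) : ℝ) + 1 / 2) := by
    simpa only [Int.cast_sub, Int.cast_one, sub_add, ← sub_eq_add_neg] using
      summable_intSign_mul_gauss ht (-(1 - 1 / 2))
  have hs1 : Summable fun m : ℤ => intSign (m - 1) * gauss t ((m - 1 : ℤ) : ℝ) *
      cschCoeff t (N - 1 - (m - 1)) := (Equiv.subRight (1 : ℤ)).summable_iff.2 (hs (N - 1))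
  have ht1 : ∑' m : ℤ, intSign (m - 1) * gauss t ((m - 1 : ℤ) : ℝ) *
      cschCoeff t (N - 1 - (m - 1)) = thetaCschConv t (N - 1) :=
    (Equiv.subRight (1 : ℤ)).tsum_eq
      fun m => intSign m * gauss t m * cschCoeff t (N - 1 - m)
  have key : nomePow t (-((N : ℝ) + 1 / 2)) * thetaCschConv t N =
      -nomePow t (N - 1 / 2) * thetaCschConv t (N - 1) := by
    rw [thetaCschConv, ← tsum_mul_left]
    simp only [hterm]
    rw [(hsz.mul_left _).tsum_add (hs1.mul_left _), tsum_mul_left, tsum_mul_left, hz, ht1,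
      mul_zero, zero_add]
  have e4 := nomePow_neg_mul t ((N : ℝ) + 1 / 2)
  have e5 : nomePow t (2 * N) = nomePow t (N - 1 / 2) * nomePow t (N + 1 / 2) := by
    rw [← nomePow_add]; congr 1; ring
  rw [e5]
  linear_combination nomePow t ((N : ℝ) + 1 / 2) * key - thetaCschConv t N * e4

/-- The normalised central coefficient of `thetaCschConv`. -/
def appellConst (t : ℝ) : ℝ := thetaCschConv t 0 / gauss t (1 / 2)

lemma thetaCschConv_eq (ht : 0 < t) (N : ℤ) :
    thetaCschConv t N = intSign N * gauss t (N + 1 / 2) * appellConst t := by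
  -- An equivalence, since q^{2N} ≠ 0 and the induction runs from 0 in both directions.
  have hstep : ∀ N : ℤ, thetaCschConv t N = intSign N * gauss t (N + 1 / 2) * appellConst t ↔
      thetaCschConv t (N - 1) =
        intSign (N - 1) * gauss t (((N - 1 : ℤ) : ℝ) + 1 / 2) * appellConst t := by
    intro N
    have e : gauss t (N + 1 / 2) =
        nomePow t (2 * N) * gauss t (((N - 1 : ℤ) : ℝ) + 1 / 2) := by
      rw [gauss_eq_nomePow, gauss_eq_nomePow, ← nomePow_add]; congr 1; push_cast; ring
    rw [thetaCschConv_recursion ht, e, intSign_sub, intSign_one, ← sub_eq_zero,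
      ← sub_eq_zero (a := thetaCschConv t (N - 1)),
      show -nomePow t (2 * N) * thetaCschConv t (N - 1) - intSign N *
        (nomePow t (2 * N) * gauss t (((N - 1 : ℤ) : ℝ) + 1 / 2)) * appellConst t =
        -nomePow t (2 * N) * (thetaCschConv t (N - 1) - intSign N * -1 *
          gauss t (((N - 1 : ℤ) : ℝ) + 1 / 2) * appellConst t) by ring,
      mul_eq_zero, or_iff_right (neg_ne_zero.2 (nomePow_pos _ _).ne')]
  induction N using Int.induction_on with
  | zero =>
    rw [appellConst, intSign_zero, Int.cast_zero, zero_add, one_mul,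
      mul_div_cancel₀ _ (gauss_pos _ _).ne']
  | succ n ih => rw [hstep, add_sub_cancel_right]; exact ih
  | pred n ih => exact (hstep _).1 ih

/-- The product of the two series at x = -1. -/
lemma thetaThree_mul_altLambert (ht : 0 < t) :
    2 * thetaThree t * altLambert t = appellConst t * thetaTwo t := by
  have h := tsum_mul_tsum_eq_conv (summable_thetaThree ht) (summable_intSign_mul_cschCoeff ht)
  rw [tsum_intSign_mul_cschCoeff ht] at h
  have h2 : ∀ N : ℤ, ∑' m : ℤ, gauss t m * (intSign (N - m) * cschCoeff t (N - m)) =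
      appellConst t * gauss t (N + 1 / 2) := by
    intro N
    have := thetaCschConv_eq ht N
    calc _ = intSign N * thetaCschConv t N := by
          rw [thetaCschConv, ← tsum_mul_left]
          exact tsum_congr fun m => by rw [intSign_sub]; ring
      _ = _ := by
          rw [this]; linear_combination appellConst t * gauss t (N + 1 / 2) * intSign_mul_self N
  simp only [h2] at h
  rw [tsum_mul_left] at h
  change thetaThree t * _ = _ * thetaTwo t at h
  linear_combination h

/-- The product differentiated at x = 1. Since 2(N-m)+1 = (2N+1) - 2m, the correction sums over N to
a multiple of ∑ (-1)^m m q^{m²} = 0. -/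
lemma thetaFour_mul_oddLambert (ht : 0 < t) :
    2 * thetaFour t * oddLambert t = appellConst t * thetaOneDeriv t := by
  have s1 : Summable fun n : ℤ => intSign n * (n : ℝ) * gauss t n := by
    simpa using summable_mul_gauss ht 0 1 (f := fun n => intSign n * (n : ℝ)) (fun n => by
      rw [abs_mul, abs_intSign]; linarith)
  have h := tsum_mul_tsum_eq_conv (summable_thetaFour ht) (summable_linear_mul_cschCoeff ht)
  have h' := tsum_mul_tsum_eq_conv s1 (summable_cschCoeff ht)
  rw [tsum_intSign_mul_self_mul_gauss, zero_mul] at h'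
  rw [tsum_linear_mul_cschCoeff ht] at h
  have h2 : ∀ N : ℤ, ∑' m : ℤ, intSign m * gauss t m * ((2 * ((N - m : ℤ) : ℝ) + 1) *
      cschCoeff t (N - m)) = appellConst t * (intSign N * (2 * N + 1) * gauss t (N + 1 / 2)) +
        -2 * ∑' m : ℤ, intSign m * (m : ℝ) * gauss t m * cschCoeff t (N - m) := by
    intro N
    have e : appellConst t * (intSign N * (2 * N + 1) * gauss t (N + 1 / 2)) =
        (2 * N + 1) * thetaCschConv t N := by rw [thetaCschConv_eq ht]; ring
    rw [e, thetaCschConv, ← tsum_mul_left, ← tsum_mul_left, ← Summable.tsum_add]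
    · exact tsum_congr fun m => by push_cast; ring
    · exact (summable_mul_conv (summable_thetaFour ht) (summable_cschCoeff ht) N).mul_left _
    · exact (summable_mul_conv s1 (summable_cschCoeff ht) N).mul_left _
  simp only [h2] at h
  rw [((summable_intSign_mul_linear_mul_gauss ht (1 / 2)).mul_left _).tsum_add
    ((summable_mul_tsum_conv s1 (summable_cschCoeff ht)).mul_left _), tsum_mul_left, tsum_mul_left,
    ← h'] at h
  change thetaFour t * _ = _ * thetaOneDeriv t + _ at h
  linear_combination h

end

/-! ### Clausen's transformation and evaluation of the Lambert series -/

/-- The terms of the double series of `altLambert`. -/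
def altLambertTerm (t : ℝ) (p : ℕ × ℕ) : ℝ :=
  (-1) ^ p.1 * nomePow t (((p.1 : ℝ) + 1 / 2) * (2 * p.2 + 1))

section

variable {t : ℝ}

lemma abs_altLambertTerm (p : ℕ × ℕ) :
    |altLambertTerm t p| = nomePow t (((p.1 : ℝ) + 1 / 2) * (2 * p.2 + 1)) := by
  rw [altLambertTerm, abs_mul, abs_pow, abs_neg, abs_one, one_pow, one_mul,
    abs_of_pos (nomePow_pos _ _)]

lemma summable_altLambertTerm (ht : 0 < t) : Summable (altLambertTerm t) := by
  rw [← summable_abs_iff]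
  simp only [abs_altLambertTerm]
  rw [summable_prod_of_nonneg fun p => (nomePow_pos _ _).le]
  refine ⟨fun n => (hasSum_cschCoeff ht n).summable, ?_⟩
  simp only [(hasSum_cschCoeff ht _).tsum_eq]
  exact (summable_cschCoeff ht).comp_injective Nat.cast_injective

lemma altLambert_eq_tsum (ht : 0 < t) : altLambert t = ∑' p : ℕ × ℕ, altLambertTerm t p := by
  rw [(summable_altLambertTerm ht).tsum_prod, altLambert]
  refine tsum_congr fun n => ?_
  rw [← (hasSum_cschCoeff ht n).tsum_eq, ← tsum_mul_left]
  rfl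

/-- Pairs of natural numbers are of the form `(m, m + j)` or `(m + j + 1, m)`. -/
def triangleEquiv : (ℕ × ℕ) ⊕ (ℕ × ℕ) ≃ ℕ × ℕ :=
  Equiv.ofBijective
    (Sum.elim (fun p => (p.1, p.1 + p.2)) (fun p => (p.1 + p.2 + 1, p.1))) (by
      constructor
      · rintro (⟨a, b⟩ | ⟨a, b⟩) (⟨c, d⟩ | ⟨c, d⟩) h <;>
          simp only [Sum.elim_inl, Sum.elim_inr, Prod.mk.injEq] at h <;>
          simp only [Sum.inl.injEq, Sum.inr.injEq, Prod.mk.injEq, reduceCtorEq] <;> omega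
      · rintro ⟨m, n⟩
        rcases le_or_gt m n with h | h
        · exact ⟨Sum.inl (m, n - m), Prod.ext rfl (Nat.add_sub_cancel' h)⟩
        · refine ⟨Sum.inr (n, m - n - 1), Prod.ext ?_ rfl⟩
          change n + (m - n - 1) + 1 = m
          omega)

lemma tsum_nat_prod_eq_triangle {f : ℕ × ℕ → ℝ} (hf : Summable f) :
    ∑' p, f p = ∑' m : ℕ, (∑' j : ℕ, f (m, m + j) + ∑' j : ℕ, f (m + j + 1, m)) := by
  have hs' := triangleEquiv.summable_iff.2 hf
  have h1 : Summable fun p : ℕ × ℕ => f (p.1, p.1 + p.2) := hs'.comp_injective Sum.inl_injective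
  have h2 : Summable fun p : ℕ × ℕ => f (p.1 + p.2 + 1, p.1) :=
    hs'.comp_injective Sum.inr_injective
  rw [h1.prod.tsum_add h2.prod, ← h1.tsum_prod, ← h2.tsum_prod, ← triangleEquiv.tsum_eq]
  exact Summable.tsum_sum h1 h2

lemma geometric_pair {x : ℝ} (hx0 : 0 < x) (hx1 : x < 1) :
    (1 - x)⁻¹ + -x * (1 + x)⁻¹ = (1 + x * x) / (1 - x * x) := by
  have d1 : 1 - x ≠ 0 := by linarith
  have d2 : 1 + x ≠ 0 := by linarith
  have d3 : 1 - x * x = (1 - x) * (1 + x) := by ring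
  rw [d3]
  field_simp
  ring

/-- The exponent (m+1/2)(2m+2j+1) equals 2(m+1/2)² + 2(m+1/2)j, so the sum over j is geometric in
the nome q² of 2t. -/
lemma tsum_altLambertTerm_row (ht : 0 < t) (m : ℕ) :
    ∑' j : ℕ, altLambertTerm t (m, m + j) =
      (-1) ^ m * gauss (2 * t) (m + 1 / 2) * (1 - nomePow (2 * t) (m + 1 / 2))⁻¹ := by
  have h2 : 0 < 2 * t := by positivity
  rw [← (hasSum_geometric_of_lt_one (nomePow_pos _ _).le
    (nomePow_lt_one h2 (by positivity : 0 < (m : ℝ) + 1 / 2))).tsum_eq, ← tsum_mul_left]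
  refine tsum_congr fun j => ?_
  rw [altLambertTerm, gauss_eq_nomePow, ← nomePow_mul_nat, mul_assoc, ← nomePow_add,
    nomePow_two_mul]
  congr 2; push_cast; ring

lemma tsum_altLambertTerm_col (ht : 0 < t) (m : ℕ) :
    ∑' j : ℕ, altLambertTerm t (m + j + 1, m) =
      (-1) ^ m * gauss (2 * t) (m + 1 / 2) *
        (-nomePow (2 * t) (m + 1 / 2) * (1 + nomePow (2 * t) (m + 1 / 2))⁻¹) := by
  have h2 : 0 < 2 * t := by positivity
  have hx0 := nomePow_pos (2 * t) (m + 1 / 2)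
  have hx1 := nomePow_lt_one h2 (by positivity : 0 < (m : ℝ) + 1 / 2)
  have hg := hasSum_geometric_of_abs_lt_one (r := -nomePow (2 * t) (m + 1 / 2))
    (by rw [abs_neg, abs_of_pos hx0]; exact hx1)
  rw [sub_neg_eq_add] at hg
  rw [← hg.tsum_eq, ← tsum_mul_left, ← tsum_mul_left]
  refine tsum_congr fun j => ?_
  have : nomePow t ((((m + j + 1 : ℕ) : ℝ) + 1 / 2) * (2 * m + 1)) =
      gauss (2 * t) (m + 1 / 2) * nomePow (2 * t) (m + 1 / 2) *
        nomePow (2 * t) (m + 1 / 2) ^ j := by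
    rw [gauss_eq_nomePow, ← nomePow_mul_nat, ← nomePow_add, ← nomePow_add, nomePow_two_mul]
    congr 1; push_cast; ring
  rw [altLambertTerm, this, neg_pow (nomePow _ _)]
  ring

lemma thetaCschConv_zero (t : ℝ) :
    thetaCschConv t 0 = ∑' m : ℤ, intSign m * gauss t m * cschCoeff t m := by
  rw [thetaCschConv, ← (Equiv.neg ℤ).tsum_eq]
  refine tsum_congr fun m => ?_
  rw [Equiv.neg_apply, intSign_neg, zero_sub, neg_neg, Int.cast_neg, gauss_neg]

/-- Under m ↦ -m-1 both the sign and the cosecant coefficient change sign, so the two terms add up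
to (-1)^m c_m (q^{m²} + q^{(m+1)²}). The factor q^{1/4} is the normalisation in `appellConst`. -/
lemma thetaCsch_pair (t : ℝ) (m : ℕ) :
    intSign m * gauss t (m : ℤ) * cschCoeff t m +
      intSign (-(m + 1)) * gauss t ((-((m : ℤ) + 1) : ℤ) : ℝ) * cschCoeff t (-(m + 1)) =
    (-1) ^ m * gauss t (m + 1 / 2) * ((1 + nomePow t (m + 1 / 2) * nomePow t (m + 1 / 2)) /
      (1 - nomePow t (m + 1 / 2) * nomePow t (m + 1 / 2))) * gauss t (1 / 2) := by
  have e1 : nomePow t (m + 1 / 2) * nomePow t (m + 1 / 2) = nomePow t (2 * m + 1) := by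
    rw [← nomePow_add]; congr 1; ring
  have e2 : gauss t (m : ℝ) * nomePow t (m + 1 / 2) = gauss t (m + 1 / 2) * gauss t (1 / 2) := by
    simp only [gauss_eq_nomePow, ← nomePow_add]; congr 1; ring
  have e3 : gauss t ((m : ℝ) + 1) = gauss t (m : ℝ) * nomePow t (2 * m + 1) := by
    simp only [gauss_eq_nomePow, ← nomePow_add]; congr 1; ring
  have hsn : intSign (-((m : ℤ) + 1)) = -(-1) ^ m := by
    rw [intSign_neg, intSign_add, intSign_natCast, intSign_one]; ring
  have hg : gauss t ((-((m : ℤ) + 1) : ℤ) : ℝ) = gauss t (m : ℝ) * nomePow t (2 * m + 1) := by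
    rw [← e3, Int.cast_neg, gauss_neg]; push_cast; rfl
  rw [hg, hsn, intSign_natCast, reflectHalf_natCast, cschCoeff_reflectHalf, cschCoeff_natCast,
    Int.cast_natCast, e1]
  linear_combination (-1) ^ m * ((1 + nomePow t (2 * m + 1)) / (1 - nomePow t (2 * m + 1))) * e2

/-- With Q = q², both sides equal ∑_{m ≥ 0} (-1)^m Q^{(m+1/2)²} (1+Q^{2m+1})/(1-Q^{2m+1}): the left
by pairing m with -m-1, the right by cutting the double series along its diagonal and summing
geometric series. -/
lemma appellConst_eq_altLambert (ht : 0 < t) : appellConst (2 * t) = altLambert t := by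
  have h2 : 0 < 2 * t := by positivity
  have hs : Summable fun m : ℤ => intSign m * gauss (2 * t) m * cschCoeff (2 * t) m := by
    refine summable_mul_cschCoeff h2 fun n => ?_
    rw [abs_mul, abs_intSign, one_mul, abs_of_pos (gauss_pos _ _), gauss, Real.exp_le_one_iff,
      neg_mul, neg_mul, neg_nonpos]
    have := Real.pi_pos
    positivity
  have hn : Summable fun m : ℕ => intSign m * gauss (2 * t) (m : ℤ) * cschCoeff (2 * t) m :=
    hs.comp_injective Nat.cast_injective
  have hneg : Summable fun m : ℕ => intSign (-(m + 1)) *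
      gauss (2 * t) ((-((m : ℤ) + 1) : ℤ) : ℝ) * cschCoeff (2 * t) (-(m + 1)) :=
    hs.comp_injective (i := fun m : ℕ => -((m : ℤ) + 1)) fun a b h => by
      simpa using h
  have hsum := tsum_of_nat_of_neg_add_one
    (f := fun m : ℤ => intSign m * gauss (2 * t) m * cschCoeff (2 * t) m) hn hneg
  rw [← thetaCschConv_zero, ← hn.tsum_add hneg] at hsum
  simp only [thetaCsch_pair] at hsum
  rw [appellConst, div_eq_iff (gauss_pos _ _).ne', hsum, altLambert_eq_tsum ht,
    tsum_nat_prod_eq_triangle (summable_altLambertTerm ht), tsum_mul_right]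
  congr 1
  refine tsum_congr fun m => ?_
  rw [tsum_altLambertTerm_row ht, tsum_altLambertTerm_col ht, ← mul_add,
    geometric_pair (nomePow_pos _ _) (nomePow_lt_one h2 (by positivity))]

lemma altLambert_two_mul (ht : 0 < t) :
    2 * thetaThree (2 * t) * altLambert (2 * t) = altLambert t * thetaTwo (2 * t) := by
  rw [thetaThree_mul_altLambert (by positivity), appellConst_eq_altLambert ht]

/-! ### Behaviour at the cusp -/

/-- Dominated convergence with the series at t = 1 as majorant; only the terms with exponent 0
survive. -/
lemma tendsto_tsum_mul_nomePow {ι : Type*} {f e : ι → ℝ} (he : ∀ i, 0 ≤ e i)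
    (hs : Summable fun i => |f i| * nomePow 1 (e i)) :
    Tendsto (fun t => ∑' i, f i * nomePow t (e i)) atTop
      (𝓝 (∑' i, if e i = 0 then f i else 0)) := by
  refine tendsto_tsum_of_dominated_convergence hs (fun i => ?_) ?_
  · rcases (he i).eq_or_lt with h | h
    · simp [← h, nomePow_zero]
    · rw [if_neg h.ne', ← mul_zero (f i)]
      refine Tendsto.const_mul _ ?_
      refine Real.tendsto_exp_atBot.comp ?_
      have h1 : Tendsto (fun t : ℝ => (-Real.pi * e i) * t) atTop atBot :=
        tendsto_id.const_mul_atTop_of_neg (by nlinarith [Real.pi_pos])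
      exact h1.congr fun t => by ring
  · filter_upwards [eventually_ge_atTop (1 : ℝ)] with t ht i
    rw [norm_mul, Real.norm_eq_abs, Real.norm_of_nonneg (nomePow_pos _ _).le]
    refine mul_le_mul_of_nonneg_left ?_ (abs_nonneg _)
    rw [nomePow, nomePow, Real.exp_le_exp]
    have := mul_le_mul_of_nonneg_right ht (mul_nonneg Real.pi_pos.le (he i))
    linarith

lemma tendsto_thetaThree : Tendsto thetaThree atTop (𝓝 1) := by
  have h := tendsto_tsum_mul_nomePow (f := fun _ : ℤ => (1 : ℝ)) (e := fun n : ℤ => (n : ℝ) ^ 2)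
    (fun n => sq_nonneg _) (by simp only [abs_one, one_mul]; exact summable_thetaThree one_pos)
  have hz : (∑' n : ℤ, if (n : ℝ) ^ 2 = 0 then (1 : ℝ) else 0) = 1 := by
    rw [tsum_eq_single 0 (by intro n hn; simp [hn])]; simp
  rw [hz] at h
  simp only [one_mul] at h
  exact h

lemma tendsto_thetaFour : Tendsto thetaFour atTop (𝓝 1) := by
  have h := tendsto_tsum_mul_nomePow (f := intSign) (e := fun n : ℤ => (n : ℝ) ^ 2)
    (fun n => sq_nonneg _) (by simp only [abs_intSign, one_mul]; exact summable_thetaThree one_pos)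
  have hz : (∑' n : ℤ, if (n : ℝ) ^ 2 = 0 then intSign n else 0) = 1 := by
    rw [tsum_eq_single 0 (by intro n hn; simp [hn])]; simp [intSign_zero]
  rw [hz] at h
  exact h

lemma int_mul_succ_nonneg (n : ℤ) : 0 ≤ (n : ℝ) * (n + 1) := by
  have : 0 ≤ n * (n + 1) := by
    rcases le_or_gt 0 n with h | h
    · positivity
    · exact mul_nonneg_of_nonpos_of_nonpos h.le (by omega)
  exact_mod_cast this

lemma gauss_half_eq (t : ℝ) (n : ℤ) :
    nomePow t (-(1 / 4)) * gauss t (n + 1 / 2) = nomePow t ((n : ℝ) * (n + 1)) := by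
  rw [gauss_eq_nomePow, ← nomePow_add]; congr 1; ring

/-- After removing q^{1/4} the exponent is n(n+1), which vanishes exactly at n = 0 and n = -1. -/
lemma tendsto_half_theta {f : ℤ → ℝ} (hs : Summable fun n : ℤ => |f n| * gauss 1 (n + 1 / 2)) :
    Tendsto (fun t => nomePow t (-(1 / 4)) * ∑' n : ℤ, f n * gauss t (n + 1 / 2)) atTop
      (𝓝 (f 0 + f (-1))) := by
  have h := tendsto_tsum_mul_nomePow (f := f) (e := fun n : ℤ => (n : ℝ) * (n + 1))
    int_mul_succ_nonneg (by
      simp only [← gauss_half_eq]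
      exact (hs.mul_left (nomePow 1 (-(1 / 4)))).congr fun n => by ring)
  have hz : (∑' n : ℤ, if (n : ℝ) * (n + 1) = 0 then f n else 0) = f 0 + f (-1) := by
    rw [tsum_eq_sum (s := {0, -1})]
    · rw [Finset.sum_pair (by norm_num)]; simp
    · intro n hn
      simp only [Finset.mem_insert, Finset.mem_singleton, not_or] at hn
      refine if_neg (mul_ne_zero (by exact_mod_cast hn.1) ?_)
      intro h
      have : ((n + 1 : ℤ) : ℝ) = 0 := by push_cast; exact h
      have := Int.cast_eq_zero.1 this
      omega
  rw [hz] at h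
  refine h.congr fun t => ?_
  rw [← tsum_mul_left]
  exact tsum_congr fun n => by rw [← gauss_half_eq]; ring

lemma tendsto_thetaTwo :
    Tendsto (fun t => nomePow t (-(1 / 4)) * thetaTwo t) atTop (𝓝 2) := by
  have h := tendsto_half_theta (f := fun _ => 1) (by simpa using summable_gauss one_pos (1 / 2))
  simp only [one_mul, one_add_one_eq_two] at h
  exact h

lemma tendsto_thetaOneDeriv :
    Tendsto (fun t => nomePow t (-(1 / 4)) * thetaOneDeriv t) atTop (𝓝 2) := by
  have h := tendsto_half_theta (f := fun n => intSign n * (2 * n + 1)) (by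
    simpa [abs_mul, abs_of_pos (gauss_pos _ _)] using
      (summable_intSign_mul_linear_mul_gauss one_pos (1 / 2)).abs)
  have hz : intSign 0 * (2 * ((0 : ℤ) : ℝ) + 1) + intSign (-1) * (2 * ((-1 : ℤ) : ℝ) + 1) = 2 := by
    rw [intSign_zero, intSign_neg, intSign_one]; norm_num
  rw [hz] at h
  exact h

lemma tendsto_altLambert :
    Tendsto (fun t => nomePow t (-(1 / 2)) * altLambert t) atTop (𝓝 1) := by
  have he : ∀ (t : ℝ) (p : ℕ × ℕ), nomePow t (-(1 / 2)) *
      nomePow t (((p.1 : ℝ) + 1 / 2) * (2 * p.2 + 1)) =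
      nomePow t (2 * (p.1 * p.2) + p.1 + p.2) := by
    intro t p
    rw [← nomePow_add]; congr 1; ring
  have h := tendsto_tsum_mul_nomePow (f := fun p : ℕ × ℕ => (-1) ^ p.1)
    (e := fun p => 2 * ((p.1 : ℝ) * p.2) + p.1 + p.2) (fun p => by positivity) (by
      refine ((summable_altLambertTerm one_pos).abs.mul_left (nomePow 1 (-(1 / 2)))).congr
        fun p => ?_
      rw [abs_altLambertTerm, he, abs_pow, abs_neg, abs_one, one_pow, one_mul])
  have hz : (∑' p : ℕ × ℕ, if 2 * ((p.1 : ℝ) * p.2) + p.1 + p.2 = 0 then (-1 : ℝ) ^ p.1 else 0)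
      = 1 := by
    rw [tsum_eq_single (0, 0)]
    · simp
    · rintro ⟨a, b⟩ hab
      refine if_neg fun h => hab ?_
      have h : 2 * (a * b) + a + b = 0 := by exact_mod_cast h
      rw [Prod.mk.injEq]; omega
  rw [hz] at h
  refine h.congr' ?_
  filter_upwards [eventually_gt_atTop (0 : ℝ)] with t ht
  rw [altLambert_eq_tsum ht, ← tsum_mul_left]
  exact tsum_congr fun p => by rw [altLambertTerm, ← he]; ring

/-! ### Identities from invariance under doubling. -/

lemma eq_of_two_mul_invariant {f : ℝ → ℝ} {L : ℝ} (hf : ∀ t, 0 < t → f t = f (2 * t))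
    (hL : Tendsto f atTop (𝓝 L)) (ht : 0 < t) : f t = L := by
  have h : ∀ n : ℕ, f (2 ^ n * t) = f t := by
    intro n
    induction n with
    | zero => simp
    | succ n ih => rw [pow_succ', mul_assoc, ← hf _ (by positivity), ih]
  have h1 : Tendsto (fun n : ℕ => (2 : ℝ) ^ n * t) atTop atTop :=
    (tendsto_pow_atTop_atTop_of_one_lt one_lt_two).atTop_mul_const ht
  have h2 := hL.comp h1
  simp only [Function.comp_def, h] at h2
  exact tendsto_nhds_unique tendsto_const_nhds h2

/-- Jacobi's derivative formula `θ₁' = θ₂ θ₃ θ₄`. -/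
theorem thetaOneDeriv_eq (ht : 0 < t) :
    thetaOneDeriv t = thetaTwo t * thetaThree t * thetaFour t := by
  have hL : Tendsto (fun t => thetaOneDeriv t / (thetaTwo t * thetaThree t * thetaFour t)) atTop
      (𝓝 (2 / (2 * 1 * 1))) := by
    refine (tendsto_thetaOneDeriv.div ((tendsto_thetaTwo.mul tendsto_thetaThree).mul
      tendsto_thetaFour) (by norm_num)).congr fun t => ?_
    simp only [Pi.div_apply, mul_assoc]
    exact mul_div_mul_left _ _ (nomePow_pos _ _).ne'
  have h := eq_of_two_mul_invariant (fun t ht => ?_) hL ht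
  · rw [div_eq_iff (by
      have := thetaTwo_pos ht; have := thetaThree_pos ht; have := thetaFour_pos ht
      positivity)] at h
    linarith
  · have h2 : 0 < 2 * t := by positivity
    have p2 := (thetaTwo_pos ht).ne'
    have p3 := (thetaThree_pos ht).ne'
    have p4 := (thetaFour_pos ht).ne'
    have q2 := (thetaTwo_pos h2).ne'
    have q3 := (thetaThree_pos h2).ne'
    have q4 := (thetaFour_pos h2).ne'
    have e1 := thetaOneDeriv_mul_thetaTwo ht
    have e2 := thetaTwo_sq ht
    have e3 := thetaThree_mul_thetaFour ht
    rw [div_eq_div_iff (by positivity) (by positivity)]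
    refine mul_left_cancel₀ p2 ?_
    linear_combination thetaTwo (2 * t) * thetaThree (2 * t) * thetaFour (2 * t) * e1 -
      thetaOneDeriv (2 * t) * thetaFour (2 * t) ^ 2 * e2 -
      thetaOneDeriv (2 * t) * thetaTwo t ^ 2 * e3

/-- `θ₂² = 4 ∑ (-1)^n q^{n + 1/2} / (1 - q^{2n + 1})`. -/
theorem altLambert_eq (ht : 0 < t) : altLambert t = thetaTwo t ^ 2 / 4 := by
  have hL : Tendsto (fun t => altLambert t / thetaTwo t ^ 2) atTop (𝓝 (1 / 2 ^ 2)) := by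
    refine (tendsto_altLambert.div (tendsto_thetaTwo.pow 2) (by norm_num)).congr fun t => ?_
    -- The normalising powers of q in numerator and denominator match and cancel.
    have : nomePow t (-(1 / 2)) = nomePow t (-(1 / 4)) ^ 2 := by
      rw [sq, ← nomePow_add]; congr 1; norm_num
    simp only [Pi.div_apply]
    rw [mul_pow, this]
    exact mul_div_mul_left _ _ (pow_ne_zero 2 (nomePow_pos _ _).ne')
  have h := eq_of_two_mul_invariant (fun t ht => ?_) hL ht
  · rw [div_eq_iff (pow_ne_zero 2 (thetaTwo_pos ht).ne')] at h
    linarith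
  · have h2 : 0 < 2 * t := by positivity
    have p2 := (thetaTwo_pos ht).ne'
    have q2 := (thetaTwo_pos h2).ne'
    have e1 := altLambert_two_mul ht
    have e2 := thetaTwo_sq ht
    rw [div_eq_div_iff (by positivity) (by positivity)]
    linear_combination -thetaTwo (2 * t) * e1 - altLambert (2 * t) * e2

/-- `θ₂² θ₃² = 4 ∑ (2n + 1) q^{n + 1/2} / (1 - q^{2n + 1})`. -/
theorem oddLambert_eq (ht : 0 < t) :
    oddLambert t = thetaTwo t ^ 2 * thetaThree t ^ 2 / 4 := by
  have h1 := thetaThree_mul_altLambert ht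
  have h2 := thetaFour_mul_oddLambert ht
  rw [altLambert_eq ht] at h1
  rw [thetaOneDeriv_eq ht] at h2
  have p2 := (thetaTwo_pos ht).ne'
  have p4 := (thetaFour_pos ht).ne'
  -- `h1` fixes `appellConst t` times θ₂, the combination in which it enters `h2` through Jacobi's
  -- formula.
  refine mul_left_cancel₀ p4 ?_
  linear_combination h2 / 2 - thetaThree t * thetaFour t / 2 * h1

end

/-! ### The arithmetic-geometric mean and complete elliptic integrals -/

/-- Gauss's integral `∫_0^{π/2} dθ / √(a² cos² θ + b² sin² θ)`. -/
def agmIntegral (a b : ℝ) : ℝ :=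
  ∫ θ in (0 : ℝ)..(Real.pi / 2), 1 / Real.sqrt (a ^ 2 * Real.cos θ ^ 2 + b ^ 2 * Real.sin θ ^ 2)

section

variable {a b : ℝ}

lemma pos_mul_cos_sq_add_mul_sin_sq (ha : 0 < a) (hb : 0 < b) (θ : ℝ) :
    0 < a * Real.cos θ ^ 2 + b * Real.sin θ ^ 2 := by
  rcases eq_or_ne (Real.cos θ) 0 with h | h
  · have : Real.sin θ ^ 2 = 1 := by have := Real.sin_sq_add_cos_sq θ; rw [h] at this; linarith
    rw [h, this]; simpa using hb
  · have : 0 < Real.cos θ ^ 2 := by positivity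
    positivity

lemma continuous_agmIntegrand (ha : 0 < a) (hb : 0 < b) :
    Continuous fun θ => 1 / Real.sqrt (a ^ 2 * Real.cos θ ^ 2 + b ^ 2 * Real.sin θ ^ 2) := by
  refine continuous_const.div (by fun_prop) fun θ => ?_
  exact (Real.sqrt_pos.2 (pos_mul_cos_sq_add_mul_sin_sq (pow_pos ha 2) (pow_pos hb 2) θ)).ne'

/-- The tangent of `2θ - φ`, where `φ` is Landen's amplitude. -/
def landenTan (a b θ : ℝ) : ℝ :=
  (a - b) * (Real.sin θ * Real.cos θ) / (a * Real.cos θ ^ 2 + b * Real.sin θ ^ 2)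

/-- The amplitude of Landen's transformation. -/
def landenAmplitude (a b θ : ℝ) : ℝ := 2 * θ - Real.arctan (landenTan a b θ)

lemma one_add_landenTan_sq (ha : 0 < a) (hb : 0 < b) (θ : ℝ) :
    1 + landenTan a b θ ^ 2 = (a ^ 2 * Real.cos θ ^ 2 + b ^ 2 * Real.sin θ ^ 2) /
      (a * Real.cos θ ^ 2 + b * Real.sin θ ^ 2) ^ 2 := by
  have hd := (pos_mul_cos_sq_add_mul_sin_sq ha hb θ).ne'
  have h1 : Real.sin θ ^ 2 = 1 - Real.cos θ ^ 2 := by linarith [Real.sin_sq_add_cos_sq θ]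
  rw [landenTan, eq_div_iff (pow_ne_zero 2 hd), div_pow, add_mul, div_mul_cancel₀ _ (pow_ne_zero 2 hd),
    mul_pow, mul_pow, h1]
  ring

lemma cos_landenAmplitude_sq (ha : 0 < a) (hb : 0 < b) (θ : ℝ) :
    Real.cos (landenAmplitude a b θ) ^ 2 = (a * Real.cos θ ^ 2 - b * Real.sin θ ^ 2) ^ 2 /
      (a ^ 2 * Real.cos θ ^ 2 + b ^ 2 * Real.sin θ ^ 2) := by
  have hd := (pos_mul_cos_sq_add_mul_sin_sq ha hb θ).ne'
  have hD := (pos_mul_cos_sq_add_mul_sin_sq (pow_pos ha 2) (pow_pos hb 2) θ).ne'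
  have hX : 0 < 1 + landenTan a b θ ^ 2 := by positivity
  have h1 : Real.cos (landenAmplitude a b θ) ^ 2 =
      (Real.cos (2 * θ) + Real.sin (2 * θ) * landenTan a b θ) ^ 2 / (1 + landenTan a b θ ^ 2) := by
    rw [landenAmplitude, Real.cos_sub, Real.cos_arctan, Real.sin_arctan,
      show Real.cos (2 * θ) * (1 / Real.sqrt (1 + landenTan a b θ ^ 2)) + Real.sin (2 * θ) *
        (landenTan a b θ / Real.sqrt (1 + landenTan a b θ ^ 2)) =
        (Real.cos (2 * θ) + Real.sin (2 * θ) * landenTan a b θ) /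
          Real.sqrt (1 + landenTan a b θ ^ 2) by ring, div_pow, Real.sq_sqrt hX.le]
  have h2 : (Real.cos (2 * θ) + Real.sin (2 * θ) * landenTan a b θ) *
      (a * Real.cos θ ^ 2 + b * Real.sin θ ^ 2) = a * Real.cos θ ^ 2 - b * Real.sin θ ^ 2 := by
    rw [landenTan, add_mul, mul_assoc, div_mul_cancel₀ _ hd, Real.cos_two_mul, Real.sin_two_mul]
    have h1 : Real.sin θ ^ 2 = 1 - Real.cos θ ^ 2 := by linarith [Real.sin_sq_add_cos_sq θ]
    rw [show 2 * Real.sin θ * Real.cos θ * ((a - b) * (Real.sin θ * Real.cos θ)) =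
      2 * (a - b) * Real.sin θ ^ 2 * Real.cos θ ^ 2 by ring, h1]
    ring
  rw [h1, one_add_landenTan_sq ha hb, ← h2, mul_pow, div_div_eq_mul_div]

/-- With d = a cos²θ + b sin²θ and D = a² cos²θ + b² sin²θ, the new form is ((a+b)d/2)²/D, while the
amplitude has derivative (a+b)d/D. The substituted integrand is therefore 2/√D. -/
lemma agmIntegrand_landenAmplitude (ha : 0 < a) (hb : 0 < b) (θ : ℝ) :
    ((a + b) / 2) ^ 2 * Real.cos (landenAmplitude a b θ) ^ 2 +
      Real.sqrt (a * b) ^ 2 * Real.sin (landenAmplitude a b θ) ^ 2 =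
    ((a + b) * (a * Real.cos θ ^ 2 + b * Real.sin θ ^ 2) / 2) ^ 2 /
      (a ^ 2 * Real.cos θ ^ 2 + b ^ 2 * Real.sin θ ^ 2) := by
  have hD := (pos_mul_cos_sq_add_mul_sin_sq (pow_pos ha 2) (pow_pos hb 2) θ).ne'
  have h1 : Real.sin (landenAmplitude a b θ) ^ 2 = 1 - Real.cos (landenAmplitude a b θ) ^ 2 := by
    linarith [Real.sin_sq_add_cos_sq (landenAmplitude a b θ)]
  rw [h1, cos_landenAmplitude_sq ha hb, Real.sq_sqrt (by positivity), eq_div_iff hD, add_mul,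
    mul_assoc, div_mul_cancel₀ _ hD, mul_assoc, sub_mul, div_mul_cancel₀ _ hD]
  have h2 : Real.sin θ ^ 2 = 1 - Real.cos θ ^ 2 := by linarith [Real.sin_sq_add_cos_sq θ]
  rw [h2]
  ring

/-- For |θ| < π/2 the amplitude is θ + arctan((b/a) tan θ). Written as 2θ minus an arctangent it
stays smooth at π/2, because the denominator of `landenTan` never vanishes. -/
lemma hasDerivAt_landenAmplitude (ha : 0 < a) (hb : 0 < b) (θ : ℝ) :
    HasDerivAt (landenAmplitude a b) ((a + b) * (a * Real.cos θ ^ 2 + b * Real.sin θ ^ 2) /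
      (a ^ 2 * Real.cos θ ^ 2 + b ^ 2 * Real.sin θ ^ 2)) θ := by
  have hd := (pos_mul_cos_sq_add_mul_sin_sq ha hb θ).ne'
  have hD := (pos_mul_cos_sq_add_mul_sin_sq (pow_pos ha 2) (pow_pos hb 2) θ).ne'
  have hs := Real.hasDerivAt_sin θ
  have hc := Real.hasDerivAt_cos θ
  have hX := ((hs.mul hc).const_mul (a - b)).div
    (((hc.pow 2).const_mul a).add ((hs.pow 2).const_mul b)) hd
  have h := ((hasDerivAt_id θ).const_mul 2).sub hX.arctan
  refine h.congr_deriv ?_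
  have hT := one_add_landenTan_sq ha hb θ
  rw [landenTan] at hT
  simp only [Pi.mul_apply, Pi.add_apply, Pi.pow_apply, Pi.div_apply]
  rw [hT, one_div, inv_div]
  rw [div_mul_div_comm, mul_comm (_ ^ 2) (_ - _), mul_div_mul_right _ _ (pow_ne_zero 2 hd),
    eq_div_iff hD, sub_mul, div_mul_cancel₀ _ hD]
  have h2 : Real.sin θ ^ 2 = 1 - Real.cos θ ^ 2 := by linarith [Real.sin_sq_add_cos_sq θ]
  simp only [Nat.cast_ofNat, Nat.add_one_sub_one, pow_one]
  ring_nf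
  simp only [show Real.sin θ ^ 4 = (Real.sin θ ^ 2) ^ 2 by ring, h2]
  ring

/-- Invariance of Gauss's integral under the arithmetic-geometric mean. -/
theorem agmIntegral_mean (ha : 0 < a) (hb : 0 < b) :
    agmIntegral ((a + b) / 2) (Real.sqrt (a * b)) = agmIntegral a b := by
  have ha1 : 0 < (a + b) / 2 := by positivity
  have hb1 : 0 < Real.sqrt (a * b) := by positivity
  set g : ℝ → ℝ := fun θ => 1 / Real.sqrt (((a + b) / 2) ^ 2 * Real.cos θ ^ 2 +
    Real.sqrt (a * b) ^ 2 * Real.sin θ ^ 2) with hg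
  have hgc : Continuous g := continuous_agmIntegrand ha1 hb1
  have hsub := intervalIntegral.integral_comp_mul_deriv (a := 0) (b := Real.pi / 2)
    (fun θ _ => hasDerivAt_landenAmplitude ha hb θ) (Continuous.continuousOn (by
      refine Continuous.div (by fun_prop) (by fun_prop) fun θ => ?_
      exact (pos_mul_cos_sq_add_mul_sin_sq (pow_pos ha 2) (pow_pos hb 2) θ).ne')) hgc
  have h0 : landenAmplitude a b 0 = 0 := by simp [landenAmplitude, landenTan]
  have h1 : landenAmplitude a b (Real.pi / 2) = Real.pi := by
    simp [landenAmplitude, landenTan]; ring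
  have hint : ∀ θ, (g ∘ landenAmplitude a b) θ * ((a + b) *
      (a * Real.cos θ ^ 2 + b * Real.sin θ ^ 2) /
      (a ^ 2 * Real.cos θ ^ 2 + b ^ 2 * Real.sin θ ^ 2)) =
      2 * (1 / Real.sqrt (a ^ 2 * Real.cos θ ^ 2 + b ^ 2 * Real.sin θ ^ 2)) := by
    intro θ
    have hd := pos_mul_cos_sq_add_mul_sin_sq ha hb θ
    have hD := pos_mul_cos_sq_add_mul_sin_sq (pow_pos ha 2) (pow_pos hb 2) θ
    simp only [hg, Function.comp_apply]
    rw [agmIntegrand_landenAmplitude ha hb]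
    set d := a * Real.cos θ ^ 2 + b * Real.sin θ ^ 2
    set D := a ^ 2 * Real.cos θ ^ 2 + b ^ 2 * Real.sin θ ^ 2
    rw [Real.sqrt_div (sq_nonneg _), Real.sqrt_sq (by positivity)]
    have hsD : Real.sqrt D ≠ 0 := (Real.sqrt_pos.2 hD).ne'
    have hab : a + b ≠ 0 := by positivity
    have hDD : Real.sqrt D * Real.sqrt D = D := Real.mul_self_sqrt hD.le
    field_simp
    linear_combination hDD
  simp only [hint] at hsub
  rw [intervalIntegral.integral_const_mul, h0, h1] at hsub
  -- The amplitude runs up to π; this symmetry halves the range and cancels the factor 2 of the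
  -- substitution.
  have hrefl : ∫ θ in (Real.pi / 2)..Real.pi, g θ = ∫ θ in (0 : ℝ)..(Real.pi / 2), g θ := by
    have h := intervalIntegral.integral_comp_sub_left g Real.pi (a := 0) (b := Real.pi / 2)
    rw [sub_zero, show Real.pi - Real.pi / 2 = Real.pi / 2 by ring] at h
    rw [← h]
    refine intervalIntegral.integral_congr fun θ _ => ?_
    simp only [hg, Real.cos_pi_sub, Real.sin_pi_sub, neg_sq]
  have hadd := intervalIntegral.integral_add_adjacent_intervals
    (hgc.intervalIntegrable (μ := MeasureTheory.volume) 0 (Real.pi / 2))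
    (hgc.intervalIntegrable (Real.pi / 2) Real.pi)
  rw [hrefl, ← hsub] at hadd
  change 2 * agmIntegral a b = _ at hsub
  change agmIntegral _ _ + agmIntegral _ _ = 2 * agmIntegral a b at hadd
  linarith

lemma agmIntegral_bounds (hb : 0 < b) (hab : b ≤ a) :
    Real.pi / 2 / a ≤ agmIntegral a b ∧ agmIntegral a b ≤ Real.pi / 2 / b := by
  have ha : 0 < a := hb.trans_le hab
  have hpi : (0 : ℝ) ≤ Real.pi / 2 := by have := Real.pi_pos; positivity
  have hc := (continuous_agmIntegrand ha hb).intervalIntegrable (μ := MeasureTheory.volume) 0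
    (Real.pi / 2)
  have hsq : b ^ 2 ≤ a ^ 2 := pow_le_pow_left₀ hb.le hab 2
  have hconst : ∀ c : ℝ, ∫ _ in (0 : ℝ)..(Real.pi / 2), 1 / c = Real.pi / 2 / c := by
    intro c
    rw [intervalIntegral.integral_const, smul_eq_mul, sub_zero, mul_one_div]
  constructor
  · rw [← hconst]
    refine intervalIntegral.integral_mono_on hpi intervalIntegrable_const hc fun θ _ => ?_
    have hD := pos_mul_cos_sq_add_mul_sin_sq (pow_pos ha 2) (pow_pos hb 2) θ
    refine one_div_le_one_div_of_le (Real.sqrt_pos.2 hD) ?_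
    rw [Real.sqrt_le_left ha.le]
    nlinarith [Real.sin_sq_add_cos_sq θ, sq_nonneg (Real.sin θ)]
  · rw [← hconst]
    refine intervalIntegral.integral_mono_on hpi hc intervalIntegrable_const fun θ _ => ?_
    refine one_div_le_one_div_of_le hb ?_
    refine Real.le_sqrt_of_sq_le ?_
    nlinarith [Real.sin_sq_add_cos_sq θ, sq_nonneg (Real.cos θ)]

end

/-! ### Theta functions parametrise the complete elliptic integral. -/

section

variable {t : ℝ}

lemma thetaFour_sq_le_thetaThree_sq (ht : 0 < t) : thetaFour t ^ 2 ≤ thetaThree t ^ 2 := by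
  rw [thetaFour_sq ht, thetaThree_sq ht]
  nlinarith [sq_nonneg (thetaTwo (2 * t))]

/-- The arithmetic and geometric means of θ₃² and θ₄² at t are θ₃² and θ₄² at 2t. As t grows both
tend to 1, and `agmIntegral_bounds` squeezes the integral to π/2. -/
lemma agmIntegral_theta (ht : 0 < t) :
    agmIntegral (thetaThree t ^ 2) (thetaFour t ^ 2) = Real.pi / 2 := by
  refine eq_of_two_mul_invariant (f := fun t => agmIntegral (thetaThree t ^ 2) (thetaFour t ^ 2))
    (fun t ht => ?_) ?_ ht
  · have p3 := thetaThree_pos ht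
    have p4 := thetaFour_pos ht
    rw [← agmIntegral_mean (pow_pos p3 2) (pow_pos p4 2), ← mul_pow, Real.sqrt_sq (by positivity),
      thetaThree_mul_thetaFour ht, thetaThree_sq ht, thetaFour_sq ht]
    congr 1; ring
  · have h3 : Tendsto (fun t => Real.pi / 2 / thetaThree t ^ 2) atTop (𝓝 (Real.pi / 2)) := by
      have h := (tendsto_const_nhds (x := Real.pi / 2)).div (tendsto_thetaThree.pow 2)
        (by norm_num)
      rwa [one_pow, div_one] at h
    have h4 : Tendsto (fun t => Real.pi / 2 / thetaFour t ^ 2) atTop (𝓝 (Real.pi / 2)) := by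
      have h := (tendsto_const_nhds (x := Real.pi / 2)).div (tendsto_thetaFour.pow 2)
        (by norm_num)
      rwa [one_pow, div_one] at h
    refine tendsto_of_tendsto_of_tendsto_of_le_of_le' h3 h4 ?_ ?_
    · filter_upwards [eventually_gt_atTop (0 : ℝ)] with t ht
      exact (agmIntegral_bounds (pow_pos (thetaFour_pos ht) 2)
        (thetaFour_sq_le_thetaThree_sq ht)).1
    · filter_upwards [eventually_gt_atTop (0 : ℝ)] with t ht
      exact (agmIntegral_bounds (pow_pos (thetaFour_pos ht) 2)
        (thetaFour_sq_le_thetaThree_sq ht)).2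

/-- The elliptic modulus `θ₂² / θ₃²` of the nome `e^{-π t}`. -/
def thetaModulus (t : ℝ) : ℝ := thetaTwo t ^ 2 / thetaThree t ^ 2

lemma one_sub_thetaModulus_sq (ht : 0 < t) :
    1 - thetaModulus t ^ 2 = (thetaFour t ^ 2 / thetaThree t ^ 2) ^ 2 := by
  have p3 := (thetaThree_pos ht).ne'
  have h := thetaThree_pow_four ht
  rw [thetaModulus]
  field_simp
  linear_combination h

lemma thetaModulus_pos (ht : 0 < t) : 0 < thetaModulus t :=
  div_pos (pow_pos (thetaTwo_pos ht) 2) (pow_pos (thetaThree_pos ht) 2)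

lemma thetaModulus_lt_one (ht : 0 < t) : thetaModulus t < 1 := by
  have h := one_sub_thetaModulus_sq ht
  have : 0 < (thetaFour t ^ 2 / thetaThree t ^ 2) ^ 2 := by
    have := thetaFour_pos ht; have := thetaThree_pos ht; positivity
  nlinarith [thetaModulus_pos ht]

theorem ellipticK_thetaModulus (ht : 0 < t) :
    ellipticK (thetaModulus t) = Real.pi / 2 * thetaThree t ^ 2 := by
  have p3 := thetaThree_pos ht
  rw [← agmIntegral_theta ht, mul_comm, agmIntegral, ← intervalIntegral.integral_const_mul,
    ellipticK]
  refine intervalIntegral.integral_congr fun θ _ => ?_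
  have e : 1 - thetaModulus t ^ 2 * Real.sin θ ^ 2 =
      ((thetaThree t ^ 2) ^ 2 * Real.cos θ ^ 2 + (thetaFour t ^ 2) ^ 2 * Real.sin θ ^ 2) /
        (thetaThree t ^ 2) ^ 2 := by
    have h1 : thetaModulus t ^ 2 = 1 - (thetaFour t ^ 2 / thetaThree t ^ 2) ^ 2 := by
      linarith [one_sub_thetaModulus_sq ht]
    rw [h1, Real.cos_sq']
    field_simp
    ring
  rw [e, Real.sqrt_div' _ (sq_nonneg _), Real.sqrt_sq (by positivity), one_div_div, mul_one_div]

/-- The complementary modulus is θ₄²/θ₃², and inversion exchanges θ₂ and θ₄. -/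
lemma sqrt_one_sub_thetaModulus_sq (ht : 0 < t) :
    Real.sqrt (1 - thetaModulus t ^ 2) = thetaModulus (1 / t) := by
  have p3 := (thetaThree_pos ht).ne'
  have hs : Real.sqrt t ≠ 0 := (Real.sqrt_pos.2 ht).ne'
  rw [one_sub_thetaModulus_sq ht, Real.sqrt_sq (by positivity), thetaModulus, thetaTwo_inv ht,
    thetaThree_inv ht, mul_pow, mul_pow, mul_div_mul_left _ _ (pow_ne_zero 2 hs)]

lemma ellipticK_complementary_thetaModulus (ht : 0 < t) :
    ellipticK (Real.sqrt (1 - thetaModulus t ^ 2)) = t * ellipticK (thetaModulus t) := by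
  rw [sqrt_one_sub_thetaModulus_sq ht, ellipticK_thetaModulus (by positivity),
    ellipticK_thetaModulus ht, thetaThree_inv ht, mul_pow, Real.sq_sqrt ht.le]
  ring

/-! ### Monotonicity of K'/K and uniqueness of the modulus. -/

lemma ellipticK_denominator_pos {k : ℝ} (hk0 : 0 ≤ k) (hk1 : k < 1) (θ : ℝ) :
    0 < 1 - k ^ 2 * Real.sin θ ^ 2 := by
  have h1 : k ^ 2 < 1 := by nlinarith
  nlinarith [Real.sin_sq_le_one θ, sq_nonneg (Real.sin θ), sq_nonneg k]

lemma continuous_ellipticK_integrand {k : ℝ} (hk0 : 0 ≤ k) (hk1 : k < 1) :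
    Continuous fun θ => 1 / Real.sqrt (1 - k ^ 2 * Real.sin θ ^ 2) :=
  continuous_const.div (by fun_prop) fun θ =>
    (Real.sqrt_pos.2 (ellipticK_denominator_pos hk0 hk1 θ)).ne'

lemma ellipticK_lt_ellipticK {k l : ℝ} (hk : 0 ≤ k) (hkl : k < l) (hl : l < 1) :
    ellipticK k < ellipticK l := by
  have hpi : (0 : ℝ) < Real.pi / 2 := by have := Real.pi_pos; positivity
  have hsq : k ^ 2 < l ^ 2 := pow_lt_pow_left₀ hkl hk two_ne_zero
  refine intervalIntegral.integral_lt_integral_of_continuousOn_of_le_of_exists_lt hpi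
    (continuous_ellipticK_integrand hk (hkl.trans hl)).continuousOn
    (continuous_ellipticK_integrand (hk.trans hkl.le) hl).continuousOn (fun θ _ => ?_)
    ⟨Real.pi / 2, ⟨hpi.le, le_rfl⟩, ?_⟩
  · have hp := ellipticK_denominator_pos (hk.trans hkl.le) hl θ
    refine one_div_le_one_div_of_le (Real.sqrt_pos.2 hp) (Real.sqrt_le_sqrt ?_)
    nlinarith [sq_nonneg (Real.sin θ)]
  · have hp := ellipticK_denominator_pos (hk.trans hkl.le) hl (Real.pi / 2)
    refine one_div_lt_one_div_of_lt (Real.sqrt_pos.2 hp) (Real.sqrt_lt_sqrt hp.le ?_)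
    rw [Real.sin_pi_div_two]
    linarith

lemma ellipticK_pos {k : ℝ} (hk : 0 ≤ k) (hk1 : k < 1) : 0 < ellipticK k := by
  have hpi : (0 : ℝ) < Real.pi / 2 := by have := Real.pi_pos; positivity
  exact intervalIntegral.intervalIntegral_pos_of_pos
    ((continuous_ellipticK_integrand hk hk1).intervalIntegrable _ _)
    (fun θ => one_div_pos.2 (Real.sqrt_pos.2 (ellipticK_denominator_pos hk hk1 θ))) hpi

lemma ellipticK_ratio_strictAnti {k l : ℝ} (hk : 0 < k) (hkl : k < l) (hl : l < 1) :
    ellipticK (Real.sqrt (1 - l ^ 2)) / ellipticK l <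
      ellipticK (Real.sqrt (1 - k ^ 2)) / ellipticK k := by
  have hsq : k ^ 2 < l ^ 2 := pow_lt_pow_left₀ hkl hk.le two_ne_zero
  have hl2 : l ^ 2 < 1 := by nlinarith
  have h1 : Real.sqrt (1 - l ^ 2) < Real.sqrt (1 - k ^ 2) :=
    Real.sqrt_lt_sqrt (by linarith) (by linarith)
  have h2 : Real.sqrt (1 - k ^ 2) < 1 := by
    rw [Real.sqrt_lt' one_pos]
    nlinarith
  exact div_lt_div₀ (ellipticK_lt_ellipticK (Real.sqrt_nonneg _) h1 h2)
    (ellipticK_lt_ellipticK hk.le hkl hl).le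
    (ellipticK_pos (Real.sqrt_nonneg _) h2).le (ellipticK_pos hk.le (hkl.trans hl))

lemma isEllipticModulus_unique {r k l : ℝ} (hk : IsEllipticModulus r k)
    (hl : IsEllipticModulus r l) : k = l := by
  rcases lt_trichotomy k l with h | h | h
  · have := ellipticK_ratio_strictAnti hk.1 h hl.2.1
    rw [hk.2.2, hl.2.2] at this
    exact absurd this (lt_irrefl _)
  · exact h
  · have := ellipticK_ratio_strictAnti hl.1 h hk.2.1
    rw [hk.2.2, hl.2.2] at this
    exact absurd this (lt_irrefl _)

lemma isEllipticModulus_thetaModulus {r : ℝ} (hr : 0 < r) :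
    IsEllipticModulus r (thetaModulus (Real.sqrt r)) := by
  have ht := Real.sqrt_pos.2 hr
  have h0 := thetaModulus_pos ht
  have h1 := thetaModulus_lt_one ht
  refine ⟨h0, h1, ?_⟩
  rw [ellipticK_complementary_thetaModulus ht, mul_div_cancel_right₀ _ (ellipticK_pos h0.le h1).ne']

theorem ellipticModulus_eq {r : ℝ} (hr : 0 < r) :
    ellipticModulus r = thetaModulus (Real.sqrt r) :=
  isEllipticModulus_unique (Classical.epsilon_spec ⟨_, isEllipticModulus_thetaModulus hr⟩)
    (isEllipticModulus_thetaModulus hr)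

end

/-! ### The function `cd₁` -/

lemma nome_rpow (r x : ℝ) : nome r ^ x = nomePow (Real.sqrt r) x := by
  rw [nome, nomePow, ← Real.exp_mul]

lemma nome_pow_odd (r : ℝ) (n : ℕ) :
    nome r ^ (2 * n + 1) = nomePow (Real.sqrt r) (2 * n + 1) := by
  rw [← nome_rpow, ← Real.rpow_natCast]; push_cast; rfl

lemma nome_rpow_div_eq_cschCoeff (r : ℝ) (n : ℕ) :
    nome r ^ (((2 * n + 1 : ℕ) : ℝ) / 2) / (1 - nome r ^ (2 * n + 1)) =
      cschCoeff (Real.sqrt r) n := by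
  rw [cschCoeff_natCast, nome_pow_odd, nome_rpow]
  congr 2; push_cast; ring

lemma cd1Term_eq (r : ℝ) (u : ℂ) (n : ℕ) :
    cd1Term r u n = (-1) ^ n * (cschCoeff (Real.sqrt r) n : ℂ) *
      Complex.cos ((2 * (n : ℂ) + 3) *
        ((Real.pi / (2 * ellipticK (ellipticModulus r)) : ℝ) : ℂ) * u) := by
  rw [cd1Term, cschCoeff_natCast, nome_pow_odd, nome_rpow, Complex.ofReal_div (nomePow _ _)]
  ring

lemma norm_exp_mul_I_le (z : ℂ) : ‖Complex.exp (z * Complex.I)‖ ≤ Real.exp |z.im| := by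
  rw [Complex.norm_exp, Real.exp_le_exp]
  simpa using neg_le_abs z.im

lemma norm_exp_neg_mul_I_le (z : ℂ) : ‖Complex.exp (-z * Complex.I)‖ ≤ Real.exp |z.im| := by
  simpa using norm_exp_mul_I_le (-z)

lemma norm_cos_le_exp_abs_im (z : ℂ) : ‖Complex.cos z‖ ≤ Real.exp |z.im| := by
  rw [Complex.cos, norm_div, Complex.norm_ofNat, div_le_iff₀ two_pos]
  linarith [norm_add_le (Complex.exp (z * Complex.I)) (Complex.exp (-z * Complex.I)),
    norm_exp_mul_I_le z, norm_exp_neg_mul_I_le z]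

lemma norm_sin_le_exp_abs_im (z : ℂ) : ‖Complex.sin z‖ ≤ Real.exp |z.im| := by
  rw [Complex.sin, norm_div, norm_mul, Complex.norm_I, mul_one, Complex.norm_ofNat,
    div_le_iff₀ two_pos]
  linarith [norm_sub_le (Complex.exp (-z * Complex.I)) (Complex.exp (z * Complex.I)),
    norm_exp_mul_I_le z, norm_exp_neg_mul_I_le z]

section

variable {r : ℝ}

lemma ellipticK_ellipticModulus (hr : 0 < r) :
    ellipticK (ellipticModulus r) = Real.pi / 2 * thetaThree (Real.sqrt r) ^ 2 := by
  rw [ellipticModulus_eq hr, ellipticK_thetaModulus (Real.sqrt_pos.2 hr)]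

lemma ellipticK_ellipticModulus_pos (hr : 0 < r) : 0 < ellipticK (ellipticModulus r) := by
  rw [ellipticK_ellipticModulus hr]
  have := thetaThree_pos (Real.sqrt_pos.2 hr)
  have := Real.pi_pos
  positivity

lemma ellipticK_complementary (hr : 0 < r) :
    ellipticK (Real.sqrt (1 - ellipticModulus r ^ 2)) =
      Real.sqrt r * ellipticK (ellipticModulus r) := by
  rw [ellipticModulus_eq hr, ellipticK_complementary_thetaModulus (Real.sqrt_pos.2 hr)]

lemma abs_im_frequency (c : ℝ) (hc : 0 ≤ c) (u : ℂ) (n : ℕ) :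
    |((2 * (n : ℂ) + 3) * (c : ℂ) * u).im| = (2 * n + 3) * (c * |u.im|) := by
  have : (2 * (n : ℂ) + 3) * (c : ℂ) * u = (((2 * n + 3) * c : ℝ) : ℂ) * u := by push_cast; ring
  rw [this, Complex.im_ofReal_mul, abs_mul, abs_of_nonneg (by positivity), mul_assoc]

/-- Since K' = √r K, the strip |Im u| < K' is exactly the range in which q e^{2δ} < 1, where δ =
π|Im u|/(2K). -/
lemma frequency_mul_lt (hr : 0 < r) {x : ℝ}
    (hx : x < ellipticK (Real.sqrt (1 - ellipticModulus r ^ 2))) :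
    2 * (Real.pi / (2 * ellipticK (ellipticModulus r)) * x) < Real.pi * Real.sqrt r := by
  have hK := ellipticK_ellipticModulus_pos hr
  rw [ellipticK_complementary hr] at hx
  have hpi := Real.pi_pos
  calc 2 * (Real.pi / (2 * ellipticK (ellipticModulus r)) * x)
      = Real.pi / ellipticK (ellipticModulus r) * x := by field_simp
    _ < Real.pi / ellipticK (ellipticModulus r) * (Real.sqrt r * ellipticK (ellipticModulus r)) :=
        mul_lt_mul_of_pos_left hx (by positivity)
    _ = _ := by field_simp

lemma norm_sign_mul_cschCoeff (hr : 0 < r) (n : ℕ) :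
    ‖(-1 : ℂ) ^ n * (cschCoeff (Real.sqrt r) n : ℂ)‖ = cschCoeff (Real.sqrt r) n := by
  rw [norm_mul, norm_pow, norm_neg, norm_one, one_pow, one_mul, Complex.norm_real,
    Real.norm_of_nonneg (cschCoeff_natCast_pos (Real.sqrt_pos.2 hr) n).le]

lemma summable_cd1Term (hr : 0 < r) {u : ℂ}
    (hu : |u.im| < ellipticK (Real.sqrt (1 - ellipticModulus r ^ 2))) :
    Summable (cd1Term r u) := by
  have hK := ellipticK_ellipticModulus_pos hr
  have hpi := Real.pi_pos
  refine Summable.of_norm_bounded (summable_linear_mul_cschCoeff_mul_exp (Real.sqrt_pos.2 hr)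
    (frequency_mul_lt hr hu)) fun n => ?_
  have hw := (cschCoeff_natCast_pos (Real.sqrt_pos.2 hr) n).le
  rw [cd1Term_eq, norm_mul, norm_sign_mul_cschCoeff hr]
  have hcos := norm_cos_le_exp_abs_im ((2 * (n : ℂ) + 3) *
    ((Real.pi / (2 * ellipticK (ellipticModulus r)) : ℝ) : ℂ) * u)
  rw [abs_im_frequency _ (by positivity)] at hcos
  refine mul_le_mul ?_ hcos (norm_nonneg _) (by positivity)
  have : (0 : ℝ) ≤ n := n.cast_nonneg
  nlinarith

lemma frequency_mul_ellipticK (hr : 0 < r) (n : ℕ) :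
    (2 * (n : ℂ) + 3) * ((Real.pi / (2 * ellipticK (ellipticModulus r)) : ℝ) : ℂ) *
      (ellipticK (ellipticModulus r) : ℂ) = (((n + 1 : ℕ) * Real.pi + Real.pi / 2 : ℝ) : ℂ) := by
  have hK := (ellipticK_ellipticModulus_pos hr).ne'
  rw [mul_assoc, ← Complex.ofReal_mul, show Real.pi / (2 * ellipticK (ellipticModulus r)) *
    ellipticK (ellipticModulus r) = Real.pi / 2 by field_simp]
  push_cast; ring

lemma cos_frequency_mul_ellipticK (hr : 0 < r) (n : ℕ) :
    Complex.cos ((2 * (n : ℂ) + 3) * ((Real.pi / (2 * ellipticK (ellipticModulus r)) : ℝ) : ℂ) *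
      (ellipticK (ellipticModulus r) : ℂ)) = 0 := by
  rw [frequency_mul_ellipticK hr, ← Complex.ofReal_cos, Real.cos_add_pi_div_two,
    Real.sin_nat_mul_pi, neg_zero, Complex.ofReal_zero]

lemma sin_frequency_mul_ellipticK (hr : 0 < r) (n : ℕ) :
    Complex.sin ((2 * (n : ℂ) + 3) * ((Real.pi / (2 * ellipticK (ellipticModulus r)) : ℝ) : ℂ) *
      (ellipticK (ellipticModulus r) : ℂ)) = (-1) ^ (n + 1) := by
  rw [frequency_mul_ellipticK hr, ← Complex.ofReal_sin, Real.sin_add_pi_div_two,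
    Real.cos_nat_mul_pi]
  push_cast; rfl

lemma cd1_ellipticK (hr : 0 < r) : cd1 r (ellipticK (ellipticModulus r) : ℂ) = 0 := by
  rw [cd1]
  simp only [cd1Term_eq, cos_frequency_mul_ellipticK hr, mul_zero, tsum_zero]

/-- The shift moves each cosine by the odd multiple (2n+3)π, so the identity holds term by term. -/
lemma cd1_add_two_mul_ellipticK (hr : 0 < r) (u : ℂ) :
    cd1 r (u + 2 * (ellipticK (ellipticModulus r) : ℂ)) = -cd1 r u := by
  have h : ∀ n, cd1Term r (u + 2 * (ellipticK (ellipticModulus r) : ℂ)) n = -cd1Term r u n := by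
    intro n
    rw [cd1Term_eq, cd1Term_eq, mul_add, mul_left_comm _ (2 : ℂ), frequency_mul_ellipticK hr,
      show (2 : ℂ) * (((n + 1 : ℕ) * Real.pi + Real.pi / 2 : ℝ) : ℂ) =
        ((n + 1 : ℕ) : ℂ) * (2 * Real.pi) + Real.pi by push_cast; ring, ← add_assoc,
      Complex.cos_add_pi, Complex.cos_add_nat_mul_two_pi, mul_neg]
  rw [cd1, cd1]
  simp only [h, tsum_neg, mul_neg]

lemma ellipticK_mul_ellipticModulus (hr : 0 < r) :
    ellipticK (ellipticModulus r) * ellipticModulus r =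
      Real.pi / 2 * thetaTwo (Real.sqrt r) ^ 2 := by
  have := (thetaThree_pos (Real.sqrt_pos.2 hr)).ne'
  rw [ellipticK_ellipticModulus hr, ellipticModulus_eq hr, thetaModulus]
  field_simp

/-- The prefactor is 4/θ₂², the reciprocal of the alternating Lambert series. -/
lemma cd1_zero (hr : 0 < r) : cd1 r 0 = 1 := by
  have ht := Real.sqrt_pos.2 hr
  have h2 := (thetaTwo_pos ht).ne'
  have hsum : ∑' n : ℕ, cd1Term r 0 n = ((thetaTwo (Real.sqrt r) ^ 2 / 4 : ℝ) : ℂ) := by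
    rw [← altLambert_eq ht, altLambert, Complex.ofReal_tsum]
    refine tsum_congr fun n => ?_
    rw [cd1Term_eq, mul_zero, Complex.cos_zero, mul_one]
    push_cast; rfl
  rw [cd1, hsum, ellipticK_mul_ellipticModulus hr, ← Complex.ofReal_mul, ← Complex.ofReal_one]
  congr 1
  have := Real.pi_ne_zero
  field_simp
  norm_num

lemma hasDerivAt_tsum_cd1Term (hr : 0 < r) :
    HasDerivAt (fun u => ∑' n, cd1Term r u n)
      ((Real.pi / (2 * ellipticK (ellipticModulus r)) *
        (oddLambert (Real.sqrt r) + 2 * ∑' n : ℕ, cschCoeff (Real.sqrt r) n) : ℝ) : ℂ)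
      (ellipticK (ellipticModulus r) : ℂ) := by
  have ht := Real.sqrt_pos.2 hr
  have hK := ellipticK_ellipticModulus_pos hr
  have hpi := Real.pi_pos
  have hK' : 0 < ellipticK (Real.sqrt (1 - ellipticModulus r ^ 2)) := by
    rw [ellipticK_complementary hr]; positivity
  set K := ellipticK (ellipticModulus r) with hKdef
  -- Half of K' keeps the ball about K inside the strip, with one majorant for all the derivatives
  -- on it.
  set R := ellipticK (Real.sqrt (1 - ellipticModulus r ^ 2)) / 2 with hR
  have hR0 : 0 < R := half_pos hK'
  have hc : 0 ≤ Real.pi / (2 * K) := by positivity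
  have hsum := (summable_linear_mul_cschCoeff_mul_exp ht
    (frequency_mul_lt hr (half_lt_self hK'))).mul_left (Real.pi / (2 * K))
  have hder := hasDerivAt_tsum_of_isPreconnected (g := fun n u => cd1Term r u n)
    (g' := fun n u => (-1) ^ n * (cschCoeff (Real.sqrt r) n : ℂ) *
      (-Complex.sin ((2 * (n : ℂ) + 3) * ((Real.pi / (2 * K) : ℝ) : ℂ) * u) *
        ((2 * (n : ℂ) + 3) * ((Real.pi / (2 * K) : ℝ) : ℂ))))
    (t := Metric.ball (K : ℂ) R) (y₀ := (K : ℂ)) (y := (K : ℂ)) hsum Metric.isOpen_ball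
    (convex_ball _ _).isPreconnected (fun n u _ => ?_) (fun n u hu => ?_)
    (Metric.mem_ball_self hR0) (summable_cd1Term hr (by simpa using hK'))
    (Metric.mem_ball_self hR0)
  · refine hder.congr_deriv ?_
    rw [oddLambert, ← tsum_mul_left, ← Summable.tsum_add
      (summable_natCast_linear_mul_cschCoeff ht)
      ((summable_natCast_cschCoeff ht).mul_left 2),
      ← tsum_mul_left, Complex.ofReal_tsum]
    refine tsum_congr fun n => ?_
    -- The sine contributes (-1)^{n+1}, which cancels the signs of the series; 2n+3 = (2n+1) + 2
    -- separates the two sums.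
    rw [sin_frequency_mul_ellipticK hr]
    have hs : (-1 : ℂ) ^ n * (-1) ^ n = 1 := by rw [← mul_pow]; norm_num
    push_cast
    rw [pow_succ]
    linear_combination (cschCoeff (Real.sqrt r) n : ℂ) * (2 * n + 3) * (Real.pi / (2 * K)) * hs
  · simp only [cd1Term_eq]
    have h := (((hasDerivAt_id u).const_mul
      ((2 * (n : ℂ) + 3) * ((Real.pi / (2 * K) : ℝ) : ℂ))).ccos).const_mul
      ((-1) ^ n * (cschCoeff (Real.sqrt r) n : ℂ))
    simpa only [id, mul_one] using h
  · have hw := (cschCoeff_natCast_pos ht n).le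
    have him : |u.im| ≤ R := by
      have h1 := Complex.abs_im_le_norm (u - K)
      rw [Complex.sub_im, Complex.ofReal_im, sub_zero] at h1
      rw [mem_ball_iff_norm] at hu
      exact h1.trans hu.le
    have hfreq : ‖(2 * (n : ℂ) + 3) * ((Real.pi / (2 * K) : ℝ) : ℂ)‖ =
        (2 * n + 3) * (Real.pi / (2 * K)) := by
      have : (2 * (n : ℂ) + 3) * ((Real.pi / (2 * K) : ℝ) : ℂ) =
        (((2 * n + 3) * (Real.pi / (2 * K)) : ℝ) : ℂ) := by push_cast; ring
      rw [this, Complex.norm_real, Real.norm_of_nonneg (by positivity)]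
    have hsin := norm_sin_le_exp_abs_im ((2 * (n : ℂ) + 3) * ((Real.pi / (2 * K) : ℝ) : ℂ) * u)
    rw [abs_im_frequency _ hc] at hsin
    have hsin' := hsin.trans (Real.exp_le_exp.2 (mul_le_mul_of_nonneg_left
      (mul_le_mul_of_nonneg_left him hc) (by positivity : (0 : ℝ) ≤ 2 * n + 3)))
    rw [norm_mul, norm_sign_mul_cschCoeff hr, norm_mul, norm_neg, hfreq]
    calc _ ≤ cschCoeff (Real.sqrt r) n * (Real.exp ((2 * n + 3) * (Real.pi / (2 * K) * R)) *
          ((2 * n + 3) * (Real.pi / (2 * K)))) := by gcongr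
      _ = _ := by ring

/-- The summand 1 is the contribution of `oddLambert`, because K²k = (π²/4) θ₂²θ₃². -/
lemma hasDerivAt_cd1 (hr : 0 < r) :
    HasDerivAt (cd1 r) ((1 + 2 * Real.pi ^ 2 / (ellipticK (ellipticModulus r) ^ 2 *
      ellipticModulus r) * ∑' n : ℕ, cschCoeff (Real.sqrt r) n : ℝ) : ℂ)
      (ellipticK (ellipticModulus r) : ℂ) := by
  have ht := Real.sqrt_pos.2 hr
  have h2 := (thetaTwo_pos ht).ne'
  have h3 := (thetaThree_pos ht).ne'
  have hpi := Real.pi_ne_zero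
  have h := (hasDerivAt_tsum_cd1Term hr).const_mul
    ((2 * Real.pi / (ellipticK (ellipticModulus r) * ellipticModulus r) : ℝ) : ℂ)
  refine h.congr_deriv ?_
  rw [← Complex.ofReal_mul, sq (ellipticK _), mul_assoc (ellipticK _),
    ellipticK_mul_ellipticModulus hr, ellipticK_ellipticModulus hr, oddLambert_eq ht]
  congr 1
  field_simp
  ring

lemma tendsto_cd1_div_sub (hr : 0 < r) :
    Tendsto (fun y : ℂ => cd1 r y / (y - (ellipticK (ellipticModulus r) : ℂ)))
      (𝓝[≠] (ellipticK (ellipticModulus r) : ℂ))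
      (𝓝 ((1 + 2 * Real.pi ^ 2 / (ellipticK (ellipticModulus r) ^ 2 * ellipticModulus r) *
        ∑' n : ℕ, cschCoeff (Real.sqrt r) n : ℝ) : ℂ)) := by
  refine (hasDerivAt_iff_tendsto_slope.1 (hasDerivAt_cd1 hr)).congr fun y => ?_
  rw [slope_def_field, cd1_ellipticK hr, sub_zero]

end
end

theorem corollary2 (r q k K K' : ℝ) (hr : 0 < r) (hq : q = nome r)
    (hk : k = ellipticModulus r) (hK : K = ellipticK k)
    (hK' : K' = ellipticK (Real.sqrt (1 - k ^ 2))) :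
    -- convergence of the series that define the quantities below
    (∀ u : ℂ, |u.im| < K' → Summable (cd1Term r u)) ∧
    Summable (fun m : ℕ => q ^ (((2 * m + 1 : ℕ) : ℝ) / 2) / (1 - q ^ (2 * m + 1))) ∧
    -- the limit at `K` (the sum is over the odd numbers `2 m + 1`)
    Tendsto (fun y : ℂ => cd1 r y / (y - (K : ℂ))) (𝓝[≠] (K : ℂ))
      (𝓝 ((1 + 2 * Real.pi ^ 2 / (K ^ 2 * k)
        * ∑' m : ℕ, q ^ (((2 * m + 1 : ℕ) : ℝ) / 2) / (1 - q ^ (2 * m + 1)) : ℝ) : ℂ)) ∧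
    -- the special values and the functional equation
    cd1 r 0 = 1 ∧
    cd1 r (K : ℂ) = 0 ∧
    cd1 r (2 * (K : ℂ)) = -1 ∧
    (∀ u : ℂ, |u.im| < K' → cd1 r (u + 2 * (K : ℂ)) = -cd1 r u) := by
  subst hq hk hK hK'
  simp only [nome_rpow_div_eq_cschCoeff]
  refine ⟨fun u hu => summable_cd1Term hr hu,
    summable_natCast_cschCoeff (Real.sqrt_pos.2 hr),
    tendsto_cd1_div_sub hr, cd1_zero hr, cd1_ellipticK hr, ?_,
    fun u _ => cd1_add_two_mul_ellipticK hr u⟩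
  -- The value at 2K is the functional equation at u = 0.
  have h := cd1_add_two_mul_ellipticK hr 0
  rwa [zero_add, cd1_zero hr] at h
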